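/- Let $\mathcal{O}$ be a discrete valuation ring of characteristic zero with fraction field $K$. Let $T$ be a local $\mathcal{O}$-algebra which is finite (not necessarily flat) as an $\mathcal{O}$-module and such that $T_K := K\otimes_{\mathcal{O}} T$ is semisimple, and let $\lambda : T\to\mathcal{O}$ be a homomorphism of $\mathcal{O}$-algebras (automatically surjective). Write $\wp_\lambda=\ker\lambda$ and $C_1^\lambda(T)=\wp_\lambda/\wp_\lambda^2$. Let $\tilde T$ be the image of $T$ in $T_K$, let $e_\lambda\in T_K$ be the idempotent such that the kernel of $\lambda_K=\mathrm{id}_K\otimes\lambda: T_K\to K$ is $(1-e_\lambda)T_K$, and put $$C_0^\lambda(T)=e_\lambda\tilde T/(\tilde T\cap e_\lambda T_K),\qquad \eta_\lambda=\mathrm{Fitt}_{\mathcal{O}}(C_0^\lambda(T)),\qquad \delta_\lambda=\mathrm{Fitt}_{\mathcal{O}}(C_1^\lambda(T))\cdot\eta_\lambda^{-1},$$ where $\mathrm{Fitt}_{\mathcal{O}}$ denotes the (zeroth) Fitting ideal of a finitely generated $\mathcal{O}$-module, and $\delta_\lambda$ (the Wiles defect of $T$ with respect to $\lambda$) is a fractional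 ideal of $\mathcal{O}$ in $K$. Assume that for some $g\ge 0$ there are $f_0,f_1,\dots,f_g\in\mathcal{O}[[x_1,\dots,x_g]]$ (no further condition is imposed on them) and an isomorphism of $\mathcal{O}$-algebras $$T\cong\mathcal{O}[[x_1,\dots,x_g]]/(f_0,f_1,\dots,f_g).$$ Then $$\delta_\lambda=\mathrm{Fitt}_{\mathcal{O}}\bigl(H_1(L_{T/\mathcal{O}}\otimes_{T,\lambda}\mathcal{O})\bigr),$$ where $L_{T/\mathcal{O}}$ is the cotangent complex of $T$ over $\mathcal{O}$. -/

import Mathlib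

open scoped TensorProduct nonZeroDivisors

noncomputable section

namespace WilesDefect

universe u v w

/-! ### Fitting ideals -/

/-- The (zeroth) Fitting ideal of a finitely generated `R`-module `M`: the ideal generated by the
determinants of all square matrices of relations between the members of a finite generating family
of `M`. All finite generating families are used at once; by the independence of the Fitting ideal
from the presentation this is the ideal computed from any single one of them. -/
def fittingIdeal (R : Type u) (M : Type v) [CommRing R] [AddCommGroup M] [Module R M] : Ideal R :=
  Ideal.span {a | ∃ (n : ℕ) (x : Fin n → M) (A : Matrix (Fin n) (Fin n) R),
    Submodule.span R (Set.range x) = ⊤ ∧ (∀ i, ∑ j, A i j • x j = 0) ∧ a = A.det}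

/-! ### The standard simplicial resolution of an algebra by polynomial algebras -/

section Resolution

variable (O : Type u) (T : Type w) [CommRing O] [CommRing T] [Algebra O T]

/-- The terms of the standard resolution, as bundled algebras: `P₀ = O[T]` is the polynomial
algebra on the underlying set of `T`, and `Pₙ₊₁ = O[Pₙ]`. -/
def resObj : ℕ → CommAlgCat.{max u w} O
  | 0 => CommAlgCat.of O (MvPolynomial T O)
  | n + 1 => CommAlgCat.of O (MvPolynomial (resObj n) O)

/-- The `n`-th term `Pₙ` of the standard resolution of `T` over `O`. -/
abbrev Res (n : ℕ) : Type (max u w) := resObj O T n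

/-- The augmentation `O[T] → T`, sending the variable `[t]` to `t`. -/
def aug₀ : Res O T 0 →ₐ[O] T := (MvPolynomial.aeval id : MvPolynomial T O →ₐ[O] T)

/-- The counit `Pₙ₊₁ = O[Pₙ] → Pₙ`, sending the variable `[p]` to `p`. -/
def counit (n : ℕ) : Res O T (n + 1) →ₐ[O] Res O T n :=
  (MvPolynomial.aeval id : MvPolynomial (Res O T n) O →ₐ[O] Res O T n)

/-- The face maps `dᵢ : Pₙ₊₁ → Pₙ` for `0 ≤ i ≤ n + 1`: the face `d₀` is the counit, and `dᵢ₊₁` is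
obtained from `dᵢ`, one level below, by applying the functor `X ↦ O[X]`. On the lowest level,
`d₁ : O[O[T]] → O[T]` comes from the augmentation `O[T] → T`. -/
def face : (n : ℕ) → Fin (n + 2) → (Res O T (n + 1) →ₐ[O] Res O T n)
  | 0 => Fin.cases (counit O T 0) fun _ =>
      (MvPolynomial.rename (aug₀ O T) : MvPolynomial (Res O T 0) O →ₐ[O] MvPolynomial T O)
  | n + 1 => Fin.cases (counit O T (n + 1)) fun i =>
      (MvPolynomial.rename (face n i) :
        MvPolynomial (Res O T (n + 1)) O →ₐ[O] MvPolynomial (Res O T n) O)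

/-- The augmentation `Pₙ → T`. -/
def aug : (n : ℕ) → (Res O T n →ₐ[O] T)
  | 0 => aug₀ O T
  | n + 1 => (aug n).comp (counit O T n)

instance instAlgebraRes (n : ℕ) : Algebra (Res O T n) T := (aug O T n).toRingHom.toAlgebra

instance instIsScalarTowerRes (n : ℕ) : IsScalarTower O (Res O T n) T :=
  IsScalarTower.of_algebraMap_eq fun x => ((aug O T n).commutes x).symm

theorem counit_comp_rename {A B : Type*} [CommRing A] [CommRing B] [Algebra O A] [Algebra O B]
    (f : A →ₐ[O] B) :
    (MvPolynomial.aeval id : MvPolynomial B O →ₐ[O] B).comp (MvPolynomial.rename f) =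
      f.comp (MvPolynomial.aeval id : MvPolynomial A O →ₐ[O] A) := by
  ext x
  simp

/-- The face maps are compatible with the augmentations. -/
theorem aug_comp_face (n : ℕ) (i : Fin (n + 2)) :
    (aug O T n).comp (face O T n i) = aug O T (n + 1) := by
  induction n with
  | zero =>
    refine Fin.cases rfl (fun i => ?_) i
    exact counit_comp_rename O (aug₀ O T)
  | succ n ih =>
    refine Fin.cases rfl (fun i => ?_) i
    have h := counit_comp_rename O (face O T n i)
    change ((aug O T n).comp (counit O T n)).comp _ = _
    rw [AlgHom.comp_assoc]
    refine (congrArg (aug O T n).comp h).trans ?_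
    rw [← AlgHom.comp_assoc, ih i]
    rfl

/-- The simplicial identities `dᵢ dⱼ₊₁ = dⱼ dᵢ` for `i ≤ j`. -/
theorem face_comp_face (n : ℕ) (i j : Fin (n + 2)) (hij : i ≤ j) :
    (face O T n i).comp (face O T (n + 1) j.succ) =
      (face O T n j).comp (face O T (n + 1) i.castSucc) := by
  induction n with
  | zero =>
    induction i using Fin.cases with
    | zero => exact counit_comp_rename O (face O T 0 j)
    | succ i =>
      induction j using Fin.cases with
      | zero => simp at hij
      | succ j =>
        obtain rfl : i = 0 := Subsingleton.elim _ _
        obtain rfl : j = 0 := Subsingleton.elim _ _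
        refine MvPolynomial.algHom_ext fun x => ?_
        change MvPolynomial.rename (aug₀ O T) (MvPolynomial.rename (face O T 0 1)
          (MvPolynomial.X x)) = MvPolynomial.rename (aug₀ O T)
            (MvPolynomial.rename (face O T 0 0) (MvPolynomial.X x))
        rw [MvPolynomial.rename_X, MvPolynomial.rename_X, MvPolynomial.rename_X,
          MvPolynomial.rename_X]
        exact congrArg MvPolynomial.X ((DFunLike.congr_fun (aug_comp_face O T 0 1) x).trans
          (DFunLike.congr_fun (aug_comp_face O T 0 0) x).symm)
  | succ n ih =>
    induction i using Fin.cases with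
    | zero => exact counit_comp_rename O (face O T (n + 1) j)
    | succ i =>
      induction j using Fin.cases with
      | zero => simp at hij
      | succ j =>
        have h := ih i j (by simpa using hij)
        refine MvPolynomial.algHom_ext fun x => ?_
        change MvPolynomial.rename (face O T n i) (MvPolynomial.rename (face O T (n + 1) j.succ)
          (MvPolynomial.X x)) = MvPolynomial.rename (face O T n j)
            (MvPolynomial.rename (face O T (n + 1) i.castSucc) (MvPolynomial.X x))
        rw [MvPolynomial.rename_X, MvPolynomial.rename_X, MvPolynomial.rename_X,
          MvPolynomial.rename_X]
        exact congrArg MvPolynomial.X (DFunLike.congr_fun h x)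

end Resolution

/-! ### The cotangent complex -/

section Homology

variable {R : Type u} [CommRing R] {X Y Z : Type v} [AddCommGroup X] [AddCommGroup Y]
  [AddCommGroup Z] [Module R X] [Module R Y] [Module R Z]

/-- The homology `ker g / im f` of a complex `X → Y → Z`. -/
def Homology (f : X →ₗ[R] Y) (g : Y →ₗ[R] Z) : Type v :=
  LinearMap.ker g ⧸ (LinearMap.range f).submoduleOf (LinearMap.ker g)

instance instAddCommGroupHomology (f : X →ₗ[R] Y) (g : Y →ₗ[R] Z) : AddCommGroup (Homology f g) :=
  inferInstanceAs
    (AddCommGroup (LinearMap.ker g ⧸ (LinearMap.range f).submoduleOf (LinearMap.ker g)))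

instance instModuleHomology (f : X →ₗ[R] Y) (g : Y →ₗ[R] Z) : Module R (Homology f g) :=
  inferInstanceAs (Module R (LinearMap.ker g ⧸ (LinearMap.range f).submoduleOf (LinearMap.ker g)))

end Homology

section Kaehler

variable {O : Type u} {T : Type w} {A B : Type v} [CommRing O] [CommRing T] [CommRing A]
  [CommRing B] [Algebra O A] [Algebra O B] [Algebra A T] [Algebra B T]

/-- For a morphism `φ : A → B` of `O`-algebras over `T`, the induced `T`-linear map
`T ⊗_A Ω_{A/O} → T ⊗_B Ω_{B/O}`, `t ⊗ da ↦ t ⊗ d(φ a)`. -/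
def kaehlerMap (φ : A →ₐ[O] B) (h : ∀ a, algebraMap B T (φ a) = algebraMap A T a) :
    T ⊗[A] Ω[A⁄O] →ₗ[T] T ⊗[B] Ω[B⁄O] :=
  letI : Algebra A B := φ.toRingHom.toAlgebra
  haveI : IsScalarTower O A B := IsScalarTower.of_algebraMap_eq fun x => (φ.commutes x).symm
  haveI : IsScalarTower A B T := IsScalarTower.of_algebraMap_eq fun x => (h x).symm
  LinearMap.liftBaseChange T
    (((TensorProduct.mk B T (Ω[B⁄O]) 1).restrictScalars A) ∘ₗ KaehlerDifferential.map O O A B)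

theorem kaehlerMap_tmul_D (φ : A →ₐ[O] B) (h : ∀ a, algebraMap B T (φ a) = algebraMap A T a)
    (t : T) (a : A) :
    kaehlerMap φ h (t ⊗ₜ KaehlerDifferential.D O A a) =
      t ⊗ₜ KaehlerDifferential.D O B (φ a) := by
  let _ : Algebra A B := φ.toRingHom.toAlgebra
  have _ : IsScalarTower O A B := IsScalarTower.of_algebraMap_eq fun x => (φ.commutes x).symm
  have _ : IsScalarTower A B T := IsScalarTower.of_algebraMap_eq fun x => (h x).symm
  simp only [kaehlerMap, LinearMap.liftBaseChange_tmul, LinearMap.comp_apply,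
    KaehlerDifferential.map_D, LinearMap.restrictScalars_apply, TensorProduct.mk_apply,
    TensorProduct.smul_tmul', smul_eq_mul, mul_one]
  rfl

end Kaehler

section Cotangent

variable (O : Type u) (T : Type w) [CommRing O] [CommRing T] [Algebra O T]

/-- The `n`-th term `Lₙ = T ⊗_{Pₙ} Ω_{Pₙ/O}` of the cotangent complex `L_{T/O}`; it is a free
`T`-module. -/
def CotangentTerm (n : ℕ) : Type (max u w) := T ⊗[Res O T n] Ω[Res O T n⁄O]

instance instAddCommGroupCotangentTerm (n : ℕ) : AddCommGroup (CotangentTerm O T n) :=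
  inferInstanceAs (AddCommGroup (T ⊗[Res O T n] Ω[Res O T n⁄O]))

instance instModuleCotangentTerm (n : ℕ) : Module T (CotangentTerm O T n) :=
  inferInstanceAs (Module T (T ⊗[Res O T n] Ω[Res O T n⁄O]))

/-- The map `Lₙ₊₁ → Lₙ` induced by the `i`-th face. -/
def cotangentFace (n : ℕ) (i : Fin (n + 2)) : CotangentTerm O T (n + 1) →ₗ[T] CotangentTerm O T n :=
  kaehlerMap (A := Res O T (n + 1)) (B := Res O T n) (face O T n i) fun a =>
    DFunLike.congr_fun (aug_comp_face O T n i) a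

/-- The differential `Lₙ₊₁ → Lₙ` of the cotangent complex `L_{T/O}`: the alternating sum of the
maps induced by the faces. -/
def cotangentD (n : ℕ) : CotangentTerm O T (n + 1) →ₗ[T] CotangentTerm O T n :=
  ∑ i : Fin (n + 2), (-1 : ℤ) ^ (i : ℕ) • cotangentFace O T n i

/-- The element `t ⊗ da` of `Lₙ`. -/
def cotangentMk (n : ℕ) (t : T) (a : Res O T n) : CotangentTerm O T n :=
  t ⊗ₜ[Res O T n] KaehlerDifferential.D O (Res O T n) a

theorem cotangentFace_mk (n : ℕ) (i : Fin (n + 2)) (t : T) (a : Res O T (n + 1)) :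
    cotangentFace O T n i (cotangentMk O T (n + 1) t a) =
      cotangentMk O T n t (face O T n i a) :=
  kaehlerMap_tmul_D _ _ t a

theorem cotangentTerm_hom_ext {n : ℕ} {N : Type*} [AddCommGroup N] [Module T N]
    {f g : CotangentTerm O T n →ₗ[T] N}
    (h : ∀ a, f (cotangentMk O T n 1 a) = g (cotangentMk O T n 1 a)) : f = g := by
  have key : ∀ (x : T ⊗[Res O T n] Ω[Res O T n⁄O]), f x = g x := by
    intro x
    induction x using TensorProduct.induction_on with
    | zero => exact (map_zero f).trans (map_zero g).symm
    | add x y hx hy => exact (map_add f x y).trans ((congrArg₂ _ hx hy).trans (map_add g x y).symm)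
    | tmul t ω =>
      have hω := KaehlerDifferential.span_range_derivation O (Res O T n) ▸
        (Submodule.mem_top : ω ∈ (⊤ : Submodule (Res O T n) (Ω[Res O T n⁄O])))
      induction hω using Submodule.span_induction generalizing t with
      | mem y hy =>
        obtain ⟨a, rfl⟩ := hy
        have e : (t ⊗ₜ[Res O T n] KaehlerDifferential.D O (Res O T n) a :
            T ⊗[Res O T n] Ω[Res O T n⁄O]) = t • (1 ⊗ₜ KaehlerDifferential.D O (Res O T n) a) := by
          rw [TensorProduct.smul_tmul', smul_eq_mul, mul_one]
        rw [e]
        exact (map_smul f t (cotangentMk O T n 1 a)).trans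
          ((congrArg (t • ·) (h a)).trans (map_smul g t (cotangentMk O T n 1 a)).symm)
      | zero =>
        rw [TensorProduct.tmul_zero]
        exact (map_zero f).trans (map_zero g).symm
      | add y z _ _ hy hz =>
        rw [TensorProduct.tmul_add]
        exact (map_add f _ _).trans ((congrArg₂ _ (hy t) (hz t)).trans (map_add g _ _).symm)
      | smul r y _ hy =>
        rw [TensorProduct.tmul_smul, TensorProduct.smul_tmul']
        exact hy _
  exact LinearMap.ext key

theorem cotangentFace_comp (n : ℕ) (i j : Fin (n + 2)) (hij : i ≤ j) :
    cotangentFace O T n i ∘ₗ cotangentFace O T (n + 1) j.succ =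
      cotangentFace O T n j ∘ₗ cotangentFace O T (n + 1) i.castSucc := by
  refine cotangentTerm_hom_ext O T fun a => ?_
  have h := DFunLike.congr_fun (face_comp_face O T n i j hij) a
  rw [AlgHom.comp_apply, AlgHom.comp_apply] at h
  simp only [LinearMap.comp_apply, cotangentFace_mk, h]

/-- The differential of the cotangent complex squares to zero. -/
theorem cotangentD_comp_cotangentD (n : ℕ) : cotangentD O T n ∘ₗ cotangentD O T (n + 1) = 0 := by
  have expand : cotangentD O T n ∘ₗ cotangentD O T (n + 1) =
      ∑ i : Fin (n + 2), ∑ j : Fin (n + 3), ((-1 : ℤ) ^ (i : ℕ) • cotangentFace O T n i) ∘ₗ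
        ((-1 : ℤ) ^ (j : ℕ) • cotangentFace O T (n + 1) j) := by
    refine LinearMap.ext fun x => ?_
    simp only [cotangentD, LinearMap.comp_apply, LinearMap.sum_apply, map_sum]
    rw [Finset.sum_comm]
  rw [expand]
  simp only [← Finset.sum_product']
  let P := Fin (n + 2) × Fin (n + 3)
  let S : Finset P := {ij : P | (ij.2 : ℕ) ≤ (ij.1 : ℕ)}
  rw [Finset.univ_product_univ, ← Finset.sum_add_sum_compl S]
  rw [← eq_neg_iff_add_eq_zero, ← Finset.sum_neg_distrib]
  let φ : ∀ ij : P, ij ∈ S → P := fun ij hij =>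
    (Fin.castLT ij.2 (lt_of_le_of_lt (Finset.mem_filter.mp hij).right (Fin.is_lt ij.1)), ij.1.succ)
  apply Finset.sum_bij φ
  · intro ij hij
    simp_rw [S, φ, Finset.compl_filter, Finset.mem_filter_univ, Fin.val_succ,
      Fin.val_castLT] at hij ⊢
    lia
  · rintro ⟨i, j⟩ hij ⟨i', j'⟩ hij' h
    rw [Prod.mk_inj]
    exact ⟨by simpa [φ] using! congr_arg Prod.snd h,
      by simpa [φ, Fin.castSucc_castLT] using! congr_arg Fin.castSucc (congr_arg Prod.fst h)⟩
  · rintro ⟨i', j'⟩ hij'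
    simp_rw [S, Finset.compl_filter, Finset.mem_filter_univ, not_le] at hij'
    refine ⟨(j'.pred <| ?_, Fin.castSucc i'), ?_, ?_⟩
    · rintro rfl
      simp only [Fin.val_zero, not_lt_zero] at hij'
    · simpa [S] using! Nat.le_sub_one_of_lt hij'
    · simp only [φ, Fin.castLT_castSucc, Fin.succ_pred]
  · rintro ⟨i, j⟩ hij
    have hij' : (j : ℕ) ≤ i := by simpa [S] using! hij
    have h := cotangentFace_comp O T n (Fin.castLT j (lt_of_le_of_lt hij' i.is_lt)) i hij'
    rw [Fin.castSucc_castLT] at h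
    simp only [φ, LinearMap.smul_comp, LinearMap.comp_smul, smul_smul, ← neg_smul, h]
    congr 1
    simp only [Fin.val_succ, Fin.val_castLT, pow_add, pow_one, mul_neg, mul_one]
    ring

variable (S : Type v) [CommRing S] [Algebra T S]

/-- The differential `S ⊗_T Lₙ₊₁ → S ⊗_T Lₙ` of the complex `L_{T/O} ⊗_T S`. The terms of `L_{T/O}`
being free over `T`, this complex is also the derived tensor product. -/
def baseChangeD (n : ℕ) : S ⊗[T] CotangentTerm O T (n + 1) →ₗ[S] S ⊗[T] CotangentTerm O T n :=
  (cotangentD O T n).baseChange S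

/-- The boundaries are cycles. -/
theorem range_baseChangeD_le_ker (n : ℕ) :
    LinearMap.range (baseChangeD O T S (n + 1)) ≤ LinearMap.ker (baseChangeD O T S n) := by
  rw [LinearMap.range_le_ker_iff, baseChangeD, baseChangeD, ← LinearMap.baseChange_comp,
    cotangentD_comp_cotangentD, LinearMap.baseChange_zero]

/-- The homology `H₁(L_{T/O} ⊗_T S)` for a `T`-algebra `S`: the cycles in degree `1` modulo the
boundaries. -/
abbrev CotangentH1 : Type (max u v w) := Homology (baseChangeD O T S 1) (baseChangeD O T S 0)

variable {O T} in
/-- The ideal `Fitt_O(H₁(L_{T/O} ⊗_{T,λ} O))` attached to `λ : T → O`; here `O` is regarded as a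
`T`-algebra through `λ`. -/
def fittingCotangentH1 (lam : T →ₐ[O] O) : Ideal O :=
  letI : Algebra T O := lam.toRingHom.toAlgebra
  fittingIdeal O (CotangentH1 O T O)

end Cotangent

/-! ### Congruence modules and the Wiles defect -/

section Congruence

variable {O : Type u} (K : Type v) {T : Type w} [CommRing O] [Field K] [Algebra O K] [CommRing T]
  [Algebra O T]

/-- The `K`-algebra homomorphism `λ_K : T_K = K ⊗_O T → K` induced by `λ : T → O`. -/
def lamK (lam : T →ₐ[O] O) : K ⊗[O] T →ₐ[K] K :=
  (Algebra.TensorProduct.rid O K K).toAlgHom.comp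
    (Algebra.TensorProduct.map (AlgHom.id K K) lam)

theorem exists_idempotent [IsSemisimpleRing (K ⊗[O] T)] (lam : T →ₐ[O] O) :
    ∃ e : K ⊗[O] T, IsIdempotentElem e ∧ RingHom.ker (lamK K lam) = Ideal.span {1 - e} := by
  obtain ⟨f, hf, h⟩ := IsSemisimpleRing.ideal_eq_span_idempotent (RingHom.ker (lamK K lam))
  exact ⟨1 - f, hf.one_sub, by simpa using h⟩

/-- The idempotent `e_λ` of the semisimple algebra `T_K` which cuts out the factor
`λ_K : T_K → K`: the kernel of `λ_K` is `(1 - e_λ) T_K`, so that `T_K = e_λ T_K × (1 - e_λ) T_K`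
with `λ_K : e_λ T_K ≅ K`. -/
def idem [IsSemisimpleRing (K ⊗[O] T)] (lam : T →ₐ[O] O) : K ⊗[O] T :=
  (exists_idempotent K lam).choose

variable (O T) in
/-- The image `T̃` of `T` in `T_K`. -/
def Ttilde : Submodule O (K ⊗[O] T) :=
  LinearMap.range (Algebra.TensorProduct.includeRight : T →ₐ[O] K ⊗[O] T).toLinearMap

/-- The module `T̃^λ = e_λ T̃`. -/
def upperLam [IsSemisimpleRing (K ⊗[O] T)] (lam : T →ₐ[O] O) : Submodule O (K ⊗[O] T) :=
  (Ttilde O K T).map (LinearMap.mulLeft O (idem K lam))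

/-- The module `T̃_λ = T̃ ∩ e_λ T_K`. -/
def lowerLam [IsSemisimpleRing (K ⊗[O] T)] (lam : T →ₐ[O] O) : Submodule O (K ⊗[O] T) :=
  Ttilde O K T ⊓ LinearMap.range (LinearMap.mulLeft O (idem K lam))

/-- The congruence module `C₀^λ(T) = T̃^λ / T̃_λ`. -/
abbrev CongruenceModule [IsSemisimpleRing (K ⊗[O] T)] (lam : T →ₐ[O] O) : Type (max v w) :=
  upperLam K lam ⧸ (lowerLam K lam).submoduleOf (upperLam K lam)

/-- The congruence ideal `η_λ`, the Fitting ideal of `C₀^λ(T)`. -/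
def congruenceIdeal [IsSemisimpleRing (K ⊗[O] T)] (lam : T →ₐ[O] O) : Ideal O :=
  fittingIdeal O (CongruenceModule K lam)

/-- The module `C₁^λ(T) = ℘_λ / ℘_λ²`, where `℘_λ` is the kernel of `λ`. -/
abbrev C1 (lam : T →ₐ[O] O) : Type w := (RingHom.ker lam).Cotangent

/-- The Wiles defect `δ_λ = Fitt_O(C₁^λ(T)) · η_λ⁻¹`, a fractional ideal of `O`. -/
def wilesDefect [IsDomain O] [IsFractionRing O K] [IsSemisimpleRing (K ⊗[O] T)]
    (lam : T →ₐ[O] O) : FractionalIdeal O⁰ K :=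
  (fittingIdeal O (C1 lam) : FractionalIdeal O⁰ K) *
    (congruenceIdeal K lam : FractionalIdeal O⁰ K)⁻¹

end Congruence

end WilesDefect
end

open scoped TensorProduct nonZeroDivisors

noncomputable section

namespace WilesDefect

universe u v w

/-! ### Fitting ideals of modules with a square presentation -/

section Fitting

variable {R M : Type*} [CommRing R] [AddCommGroup M] [Module R M]

/-! Once power series are replaced by polynomials, `T = O[X₁,…,Xₙ]/I` with `I = (f₀,…,fₙ)` and every
variable mapping into `ker λ`. Put `J = (X₁,…,Xₙ)`. Then `C₁ = J/(I + J²)` and `H₁(L ⊗ O) = (I ∩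
J²)/JI`.

Write `fⱼ = ∑ᵢ Nⱼᵢ Xᵢ`, let `Δⱼ` be the signed maximal minors of `N` and `Dⱼ = Δⱼ(0)`. The matrix
`N(0)` presents `C₁`, which is torsion because `λ_K` splits off a factor of `T_K`; so `D ≠ 0`. If
`Dₖ` has least valuation, the left kernel of `N(0)` is spanned by `c = D/Dₖ`. As `cₖ = 1`, the
`k`-th relation is redundant and `Fitt(C₁) = (Dₖ)`. The module `H₁` is cyclic on the class of `∑ cⱼ
fⱼ`, and its annihilator `(w)` consists of the `a` for which `a·c` is the constant term of a syzygy
of the `fⱼ`.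

The heart is a duality between syzygies and linear forms on `T`. A form `φ` yields a syzygy with
constant terms `φ(Δⱼ(t))` (`exists_relation_of_form`, by Bezout matrices), and every syzygy has the
constant terms of one of these (`exists_form_of_relation`, by a residue functional). So `(w)` is the
set of values of linear forms at `Δₖ(t)`, and modulo torsion `Δₖ(t) = w·s₀` where some form takes
the value `1` at `s₀`. By Cramer's rule `ker λ` kills `Δₖ(t)`, hence kills `s₀` up to torsion; this
makes `δ = λ(s₀)` a generator of the congruence ideal. Applying `λ` gives `Dₖ = w·δ`, which is the
theorem (`IsPresentation.exists_invariants`). -/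

theorem det_dvd_det_of_relations {m n : ℕ} (e : Fin n → M)
    (he : Submodule.span R (Set.range e) = ⊤) (D : Matrix (Fin n) (Fin n) R)
    (hD' : ∀ v : Fin n → R, ∑ j, v j • e j = 0 → ∃ u : Fin n → R, v = Matrix.vecMul u D)
    (x : Fin m → M) (hx : Submodule.span R (Set.range x) = ⊤) (A : Matrix (Fin m) (Fin m) R)
    (hA : ∀ i, ∑ j, A i j • x j = 0) : D.det ∣ A.det := by
  have h1 : ∀ j, ∃ v : Fin n → R, ∑ l, v l • e l = x j := fun j =>
    (Submodule.mem_span_range_iff_exists_fun R).1 (he ▸ Submodule.mem_top)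
  have h2 : ∀ j, ∃ v : Fin m → R, ∑ l, v l • x l = e j := fun j =>
    (Submodule.mem_span_range_iff_exists_fun R).1 (hx ▸ Submodule.mem_top)
  choose V hV using h1
  choose C hC using h2
  have h3 : ∀ i, ∃ u : Fin n → R, (A * Matrix.of V) i = Matrix.vecMul u D := by
    refine fun i => hD' _ ?_
    simp only [Matrix.mul_apply, Matrix.of_apply, Finset.sum_smul]
    rw [Finset.sum_comm, ← hA i]
    refine Finset.sum_congr rfl fun j _ => ?_
    rw [← hV j, Finset.smul_sum]
    simp only [mul_smul]
  have h4 : ∀ i, ∃ u : Fin n → R, (Matrix.of C * Matrix.of V - (1 : Matrix (Fin n) (Fin n) R)) i =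
      Matrix.vecMul u D := by
    refine fun i => hD' _ ?_
    simp only [Matrix.sub_apply, sub_smul, Finset.sum_sub_distrib, Matrix.mul_apply,
      Matrix.of_apply, Finset.sum_smul, Matrix.one_apply]
    rw [Finset.sum_comm, sub_eq_zero]
    simp only [ite_smul, one_smul, zero_smul, Finset.sum_ite_eq, Finset.mem_univ, if_true]
    rw [← hC i]
    refine Finset.sum_congr rfl fun j _ => ?_
    rw [← hV j, Finset.smul_sum]
    simp only [mul_smul]
  choose F hF using h3
  choose E hE using h4
  have hF' : A * Matrix.of V = Matrix.of F * D := by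
    ext i j
    rw [hF i]
    rfl
  have hE' : Matrix.of C * Matrix.of V - 1 = Matrix.of E * D := by
    ext i j
    rw [hE i]
    rfl
  -- The families are compared both ways, `x = V e` and `e = C x`. The rows of `A V` and of `C V -
  -- 1` are relations of `e`, hence factor through `D`. Determinants of this block identity exhibit
  -- `det A` as a multiple of `det (-D)`.
  have key : Matrix.fromBlocks A (Matrix.of F) (Matrix.of C) (Matrix.of E) *
      Matrix.fromBlocks 1 (Matrix.of V) 0 (-D) = Matrix.fromBlocks A 0 (Matrix.of C) 1 := by
    rw [Matrix.fromBlocks_multiply]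
    simp only [Matrix.mul_one, Matrix.mul_zero, add_zero, Matrix.mul_neg, hF', ← hE',
      add_neg_cancel]
    congr 1
    abel
  have hdet := congrArg Matrix.det key
  rw [Matrix.det_mul, Matrix.det_fromBlocks_zero₂₁, Matrix.det_fromBlocks_zero₁₂, Matrix.det_one,
    Matrix.det_one, Matrix.det_neg, one_mul, mul_one] at hdet
  rw [← hdet]
  exact (Dvd.intro_left _ rfl).mul_left _

/-- The Fitting ideal of a module with as many relations as generators is generated by the
determinant of the relation matrix. -/
theorem fittingIdeal_eq_span_det {n : ℕ} (e : Fin n → M)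
    (he : Submodule.span R (Set.range e) = ⊤) (D : Matrix (Fin n) (Fin n) R)
    (hD : ∀ i, ∑ j, D i j • e j = 0)
    (hD' : ∀ v : Fin n → R, ∑ j, v j • e j = 0 → ∃ u : Fin n → R, v = Matrix.vecMul u D) :
    fittingIdeal R M = Ideal.span {D.det} := by
  refine le_antisymm (Ideal.span_le.2 ?_) (Ideal.span_mono ?_)
  · rintro _ ⟨m, x, A, hx, hA, rfl⟩
    exact Ideal.mem_span_singleton.2 (det_dvd_det_of_relations e he D hD' x hx A hA)
  · rintro _ rfl
    exact ⟨n, e, D, he, hD, rfl⟩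

theorem fittingIdeal_of_cyclic (z : M) (hz : ∀ x : M, ∃ r : R, x = r • z) (w : R)
    (hw : ∀ r : R, r • z = 0 ↔ w ∣ r) : fittingIdeal R M = Ideal.span {w} := by
  have h := fittingIdeal_eq_span_det (R := R) (fun _ : Fin 1 => z) (by
      rw [eq_top_iff]
      intro x _
      obtain ⟨r, rfl⟩ := hz x
      exact Submodule.smul_mem _ _ (Submodule.subset_span ⟨0, rfl⟩))
    (Matrix.of fun _ _ => w) (by simp [(hw w).2 dvd_rfl]) (by
      intro v hv
      obtain ⟨u, hu⟩ := (hw (v 0)).1 (by simpa using hv)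
      refine ⟨fun _ => u, funext fun i => ?_⟩
      rw [Subsingleton.elim i 0, hu]
      simp [Matrix.vecMul, dotProduct, mul_comm])
  simpa using h

end Fitting

/-! ### Maximal minors of a matrix with one more row than columns -/

section Minors

variable {R : Type*} [CommRing R] {n : ℕ}

/-- The matrix obtained by adding `v` as the first column. -/
def addCol (v : Fin (n + 1) → R) (N : Matrix (Fin (n + 1)) (Fin n) R) :
    Matrix (Fin (n + 1)) (Fin (n + 1)) R :=
  Matrix.of fun i => Fin.cons (v i) (N i)

/-- The vector of signed maximal minors. -/
def signedMinors (N : Matrix (Fin (n + 1)) (Fin n) R) (j : Fin (n + 1)) : R :=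
  (-1) ^ (j : ℕ) * (N.submatrix j.succAbove id).det

theorem det_addCol (v : Fin (n + 1) → R) (N : Matrix (Fin (n + 1)) (Fin n) R) :
    (addCol v N).det = ∑ j, v j * signedMinors N j := by
  rw [Matrix.det_succ_column_zero]
  refine Finset.sum_congr rfl fun j _ => ?_
  have : (addCol v N).submatrix j.succAbove Fin.succ = N.submatrix j.succAbove id := by
    ext a b
    simp [addCol]
  rw [this, signedMinors]
  simp only [addCol, Matrix.of_apply, Fin.cons_zero]
  ring

/-- Laplace expansion of a determinant in which column `i` of `N` occurs twice. -/
theorem signedMinors_vecMul (N : Matrix (Fin (n + 1)) (Fin n) R) (i : Fin n) :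
    ∑ j, signedMinors N j * N j i = 0 := by
  have h := det_addCol (fun j => N j i) N
  rw [Matrix.det_zero_of_column_eq (i := 0) (j := i.succ) (Fin.succ_ne_zero i).symm
    (fun k => by simp [addCol])] at h
  rw [h]
  exact Finset.sum_congr rfl fun j _ => mul_comm _ _

theorem map_signedMinors {S : Type*} [CommRing S] (φ : R →+* S)
    (N : Matrix (Fin (n + 1)) (Fin n) R) (j : Fin (n + 1)) :
    φ (signedMinors N j) = signedMinors (N.map φ) j := by
  rw [signedMinors, signedMinors, map_mul, map_pow, map_neg, map_one, RingHom.map_det]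
  rfl

theorem det_mul_eq_zero_of_mulVec {ι : Type*} [Fintype ι] [DecidableEq ι] (N : Matrix ι ι R)
    (x : ι → R) (hx : ∀ j, ∑ i, N j i * x i = 0) (i : ι) : N.det * x i = 0 := by
  have h1 : N.mulVec x = 0 := funext hx
  have h2 : (N.adjugate * N).mulVec x = 0 := by rw [← Matrix.mulVec_mulVec, h1, Matrix.mulVec_zero]
  rw [Matrix.adjugate_mul, Matrix.smul_mulVec, Matrix.one_mulVec] at h2
  exact congrFun h2 i

/-- Cramer's rule for the square system left after deleting row `j`. -/
theorem signedMinors_mul_eq_zero (N : Matrix (Fin (n + 1)) (Fin n) R)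
    (x : Fin n → R) (hx : ∀ j, ∑ i, N j i * x i = 0) (j : Fin (n + 1)) (i : Fin n) :
    signedMinors N j * x i = 0 := by
  rw [signedMinors, mul_assoc,
    det_mul_eq_zero_of_mulVec (N.submatrix j.succAbove id) x (fun k => hx _) i, mul_zero]

theorem mul_addCol (P : Matrix (Fin (n + 1)) (Fin (n + 1)) R) (v : Fin (n + 1) → R)
    (N : Matrix (Fin (n + 1)) (Fin n) R) :
    P * addCol v N = addCol (P.mulVec v) (P * N) := by
  ext i j
  refine Fin.cases ?_ (fun j => ?_) j <;> simp [addCol, Matrix.mul_apply, Matrix.mulVec, dotProduct]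

/-- A square matrix all of whose rows but the `i`-th kill `y` and whose `i`-th row is an elementary
Koszul relation of `y` is singular. -/
theorem det_updateRow_koszul {ι : Type*} [Fintype ι] [DecidableEq ι] (X : Matrix ι ι R) (y : ι → R)
    (i : ι) (hX : ∀ j, j ≠ i → ∑ k, X j k * y k = 0) (p q : ι) :
    (X.updateRow i (y p • Pi.single q 1 - y q • Pi.single p 1)).det = 0 := by
  have key : y p * (X.updateRow i (Pi.single q 1)).det =
      y q * (X.updateRow i (Pi.single p 1)).det := by
    -- Only row `i` of `Z` fails to kill `y`, so `Z y = y_q eᵢ`. Coordinate `p` of Cramer's rule for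
    -- this system is the claimed identity.
    set Z := X.updateRow i (Pi.single q 1) with hZ
    have hZy : Z.mulVec y = y q • Pi.single i 1 := by
      ext j
      by_cases hj : j = i
      · subst hj
        simp [hZ, Matrix.mulVec, dotProduct, Pi.single_apply]
      · simp [hZ, Matrix.mulVec, dotProduct, hj, hX j hj]
    have h1 : Z.cramer (Z.mulVec y) = Z.det • y := by
      rw [Matrix.cramer_eq_adjugate_mulVec, Matrix.mulVec_mulVec, Matrix.adjugate_mul,
        Matrix.smul_mulVec, Matrix.one_mulVec]
    have h2 := congrFun h1 p
    rw [hZy, map_smul] at h2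
    have h3 : Z.cramer (Pi.single i 1) p = (X.updateRow i (Pi.single p 1)).det := by
      rw [Matrix.cramer_eq_adjugate_mulVec, Matrix.mulVec_single_one, Matrix.col_apply,
        Matrix.adjugate_apply, hZ, Matrix.updateRow_idem]
    rw [Pi.smul_apply, Pi.smul_apply, h3, smul_eq_mul, smul_eq_mul] at h2
    rw [h2, mul_comm]
  rw [sub_eq_add_neg, Matrix.det_updateRow_add, ← neg_smul, Matrix.det_updateRow_smul,
    Matrix.det_updateRow_smul, key]
  ring

end Minors

/-! ### Koszul relations -/

section Koszul

variable {ι R S : Type*} [DecidableEq ι] [CommRing R] [CommRing S]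

/-- The submodule of `R^ι` spanned by the elementary Koszul relations of `y`. -/
def koszulRelations (y : ι → R) : Submodule R (ι → R) :=
  Submodule.span R (Set.range fun pq : ι × ι =>
    y pq.1 • Pi.single pq.2 (1 : R) - y pq.2 • Pi.single pq.1 (1 : R))

theorem mul_sub_mul_mem_koszulRelations (y : ι → R) (p q : ι) (c : R) :
    (Pi.single q (c * y p) - Pi.single p (c * y q) : ι → R) ∈ koszulRelations y := by
  have h := (koszulRelations y).smul_mem c (Submodule.subset_span ⟨(p, q), rfl⟩)
  convert h using 1
  ext k
  simp only [Pi.sub_apply, Pi.smul_apply, Pi.single_apply, smul_eq_mul]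
  split_ifs <;> ring

theorem map_mem_koszulRelations (φ : R →+* S) (y κ : ι → R) (hκ : κ ∈ koszulRelations y) :
    (fun i => φ (κ i)) ∈ koszulRelations fun i => φ (y i) := by
  induction hκ using Submodule.span_induction with
  | mem x hx =>
    obtain ⟨⟨p, q⟩, rfl⟩ := hx
    convert mul_sub_mul_mem_koszulRelations (fun i => φ (y i)) p q 1 using 1
    ext k
    simp [Pi.single_apply, apply_ite φ]
  | zero =>
    convert Submodule.zero_mem (koszulRelations fun i => φ (y i)) using 1
    ext k
    simp
  | add x z _ _ hx hz =>
    convert Submodule.add_mem _ hx hz using 1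
    ext k
    simp
  | smul c x _ hx =>
    convert Submodule.smul_mem _ (φ c) hx using 1
    ext k
    simp

variable [Fintype ι]

theorem det_updateRow_of_mem_koszulRelations (X : Matrix ι ι R) (y : ι → R) (i : ι)
    (hX : ∀ j, j ≠ i → ∑ k, X j k * y k = 0) (κ : ι → R) (hκ : κ ∈ koszulRelations y) :
    (X.updateRow i κ).det = 0 := by
  induction hκ using Submodule.span_induction with
  | mem x hx =>
    obtain ⟨⟨p, q⟩, rfl⟩ := hx
    exact det_updateRow_koszul X y i hX p q
  | zero => exact Matrix.det_eq_zero_of_row_eq_zero i (by simp)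
  | add x z _ _ hx hz => rw [Matrix.det_updateRow_add, hx, hz, add_zero]
  | smul c x _ hx => rw [Matrix.det_updateRow_smul, hx, mul_zero]

/-- The rows are exchanged one at a time; each exchange alters the determinant by one having a
Koszul relation as a row and all other rows killing `y`, which vanishes. -/
theorem det_eq_det_of_sub_mem_koszulRelations (X X' : Matrix ι ι R) (y : ι → R)
    (hX : ∀ j, ∑ k, X j k * y k = 0) (hX' : ∀ j, ∑ k, X' j k * y k = 0)
    (h : ∀ j, X j - X' j ∈ koszulRelations y) : X.det = X'.det := by
  have key : ∀ s : Finset ι,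
      (Matrix.of fun j => if j ∈ s then X j else X' j).det = X'.det := by
    intro s
    induction s using Finset.induction_on with
    | empty => exact congrArg Matrix.det (by ext; simp)
    | insert i s hi ih =>
      set Z : Matrix ι ι R := Matrix.of fun j => if j ∈ s then X j else X' j with hZ
      have h1 : (Matrix.of fun j => if j ∈ insert i s then X j else X' j) =
          Z.updateRow i (X' i + (X i - X' i)) := by
        ext j k
        by_cases hj : j = i
        · subst hj
          simp
        · simp [hj, hZ]
      have h2 : Z.updateRow i (X' i) = Z := by
        ext j k
        by_cases hj : j = i
        · subst hj
          simp [hZ, hi]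
        · simp [hj]
      rw [h1, Matrix.det_updateRow_add, h2, ih,
        det_updateRow_of_mem_koszulRelations Z y i _ _ (h i), add_zero]
      intro j _
      by_cases hj : j ∈ s <;> simp [hZ, hj, hX, hX']
  have h1 := key Finset.univ
  simp only [Finset.mem_univ, if_true] at h1
  exact h1

/-- The preceding equality, read over `R ⧸ I`. -/
theorem det_sub_det_mem (I : Ideal R) (X X' : Matrix ι ι R) (y : ι → R)
    (hX : ∀ j, ∑ k, X j k * y k ∈ I) (hX' : ∀ j, ∑ k, X' j k * y k ∈ I)
    (h : ∀ j, X j - X' j ∈ koszulRelations y) : X.det - X'.det ∈ I := by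
  rw [← Ideal.Quotient.eq, RingHom.map_det, RingHom.map_det]
  refine det_eq_det_of_sub_mem_koszulRelations _ _ (fun i => Ideal.Quotient.mk I (y i)) ?_ ?_ ?_
  · intro j
    simpa using Ideal.Quotient.eq_zero_iff_mem.2 (hX j)
  · intro j
    simpa using Ideal.Quotient.eq_zero_iff_mem.2 (hX' j)
  · intro j
    convert map_mem_koszulRelations (Ideal.Quotient.mk I) y _ (h j) using 1
    ext k
    simp

open MvPolynomial in
/-- Every relation between the variables of a polynomial ring is a Koszul relation. -/
theorem mem_koszulRelations_X (κ : ι → MvPolynomial ι R) (h : ∑ i, κ i * X i = 0) :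
    κ ∈ koszulRelations (X : ι → MvPolynomial ι R) := by
  have key : ∀ (s : Finset ι) (κ : ι → MvPolynomial ι R), (∀ i, i ∉ s → κ i = 0) →
      ∑ i ∈ s, κ i * X i = 0 → κ ∈ koszulRelations (X : ι → MvPolynomial ι R) := by
    intro s
    induction s using Finset.induction_on with
    | empty =>
      intro κ hκ _
      rw [show κ = 0 from funext fun i => hκ i (by simp)]
      exact Submodule.zero_mem _
    | insert j s hj ih =>
      intro κ hκ hs
      rw [Finset.sum_insert hj] at hs
      -- The variable `X j` is regular modulo the variables in `s`, so `κ j` itself lies in their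
      -- ideal. Koszul relations between `j` and elements of `s` then clear the `j`-th entry, and
      -- the induction hypothesis applies to what remains.
      have h1 : κ j * X j ∈ Ideal.span (X '' (s : Set ι) : Set (MvPolynomial ι R)) := by
        rw [eq_neg_of_add_eq_zero_left hs]
        exact neg_mem (sum_mem fun i hi => Ideal.mul_mem_left _ _
          (Ideal.subset_span ⟨i, hi, rfl⟩))
      have h2 : κ j ∈ Ideal.span (X '' (s : Set ι) : Set (MvPolynomial ι R)) := by
        rw [mem_ideal_span_X_image] at h1 ⊢
        intro m hm
        obtain ⟨i, hi, hmi⟩ := h1 (m + Finsupp.single j 1) (by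
          rw [mem_support_iff, coeff_mul_X]
          exact mem_support_iff.1 hm)
        refine ⟨i, hi, ?_⟩
        have : j ≠ i := fun h => hj (h ▸ hi)
        simpa [Finsupp.single_apply, this] using hmi
      have h3 : ∃ b : ι → MvPolynomial ι R, (∀ i, i ∉ s → b i = 0) ∧
          κ j = ∑ i ∈ s, b i * X i := by
        obtain ⟨b, hb⟩ := (Submodule.mem_span_image_finset_iff_exists_fun _).1 h2
        refine ⟨fun i => if h : i ∈ s then b ⟨i, h⟩ else 0, fun i hi => by simp [hi], ?_⟩
        refine hb.symm.trans (Eq.trans ?_ (Finset.sum_coe_sort s fun i =>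
          (if h : i ∈ s then b ⟨i, h⟩ else 0) * X i))
        exact Finset.sum_congr rfl fun i _ => by simp
      obtain ⟨b, hb, hbκ⟩ := h3
      have h4 := ih (fun i => if i = j then (0 : MvPolynomial ι R) else κ i + b i * X j)
        (fun i hi => by
          by_cases hij : i = j
          · simp [hij]
          · simp [hij, hb i hi, hκ i (by simp [hij, hi])])
        (by
          rw [← hs, hbκ, Finset.sum_mul, ← Finset.sum_add_distrib]
          refine Finset.sum_congr rfl fun i hi => ?_
          have : i ≠ j := fun h => hj (h ▸ hi)
          rw [if_neg this]
          ring)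
      have h5 : κ = (fun i => if i = j then 0 else κ i + b i * X j) +
          ∑ i ∈ s, (Pi.single j (b i * X i) - Pi.single i (b i * X j)) := by
        ext1 k
        rw [Pi.add_apply, Finset.sum_apply]
        by_cases hk : k = j
        · subst hk
          rw [if_pos rfl, zero_add, hbκ]
          refine Finset.sum_congr rfl fun i hi => ?_
          have : k ≠ i := fun h => hj (h ▸ hi)
          simp [this]
        · simp only [Pi.sub_apply, Pi.single_apply, hk, if_false, zero_sub,
            Finset.sum_neg_distrib, Finset.sum_ite_eq]
          by_cases hks : k ∈ s
          · simp [hks]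
          · simp [hks, hb k hks]
      rw [h5]
      exact Submodule.add_mem _ h4 (Submodule.sum_mem _ fun i _ =>
        mul_sub_mul_mem_koszulRelations _ _ _ _)
  exact key Finset.univ κ (by simp) h

end Koszul

/-! ### The residue functional of a product of monic polynomials -/

section Residue

open MvPolynomial

variable {ι R : Type*} [Fintype ι] [CommRing R]

/-- The functional on polynomials in several variables which is the product of functionals on
polynomials in one variable. -/
def prodFunctional (ℓ : ι → (Polynomial R →ₗ[R] R)) : MvPolynomial ι R →ₗ[R] R :=
  (basisMonomials ι R).constr R fun m => ∏ i, ℓ i (Polynomial.monomial (m i) 1)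

/-- Both sides are multilinear in `p`, so it suffices to compare them on powers of the variable. -/
theorem prodFunctional_prod (ℓ : ι → (Polynomial R →ₗ[R] R)) (p : ι → Polynomial R) :
    prodFunctional ℓ (∏ i, Polynomial.aeval (X i) (p i)) = ∏ i, ℓ i (p i) := by
  have key : (prodFunctional ℓ).compMultilinearMap
      ((MultilinearMap.mkPiAlgebra R ι (MvPolynomial ι R)).compLinearMap fun i =>
        (Polynomial.aeval (X i)).toLinearMap) =
      (MultilinearMap.mkPiAlgebra R ι R).compLinearMap ℓ := by
    refine Module.Basis.ext_multilinear (fun _ => Polynomial.basisMonomials R) fun m => ?_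
    simp only [LinearMap.compMultilinearMap_apply, MultilinearMap.compLinearMap_apply,
      MultilinearMap.mkPiAlgebra_apply, Polynomial.coe_basisMonomials, AlgHom.toLinearMap_apply,
      Polynomial.aeval_monomial, map_one, one_mul]
    have h : (∏ i, X i ^ m i : MvPolynomial ι R) =
        basisMonomials ι R (Finsupp.equivFunOnFinite.symm m) := by
      rw [coe_basisMonomials]
      dsimp only
      rw [monomial_eq, C_1, one_mul, Finsupp.prod_fintype _ _ (by simp)]
      simp
    rw [h, prodFunctional, Module.Basis.constr_basis]
    simp
  exact congrArg (fun F => F p) key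

variable [DecidableEq ι]

/-- For monic polynomials `hᵢ = Y qᵢ` there is a functional killing the ideal generated by the
`hᵢ(Xᵢ)` with value `1` at the product of the `qᵢ(Xᵢ)`. -/
theorem exists_residue [Nontrivial R] (q : ι → Polynomial R) (hq : ∀ i, (q i).Monic) :
    ∃ τ : MvPolynomial ι R →ₗ[R] R,
      (∀ x ∈ Ideal.span (Set.range fun i =>
        (Polynomial.aeval (X i) (Polynomial.X * q i) : MvPolynomial ι R)), τ x = 0) ∧
      τ (∏ i, Polynomial.aeval (X i) (q i)) = 1 := by
  have hm : ∀ i, (Polynomial.X * q i).Monic := fun i => Polynomial.monic_X.mul (hq i)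
  -- The one-variable residue: the top coefficient of the remainder modulo `Y qᵢ`, which sits in
  -- degree `deg qᵢ` because `Y qᵢ` has degree `deg qᵢ + 1`.
  let ℓ : ι → (Polynomial R →ₗ[R] R) := fun i =>
    Polynomial.lcoeff R (q i).natDegree ∘ₗ Polynomial.modByMonicHom (Polynomial.X * q i)
  have hℓ : ∀ i p, ℓ i (Polynomial.X * q i * p) = 0 := by
    intro i p
    have : Polynomial.X * q i * p %ₘ (Polynomial.X * q i) = 0 :=
      (Polynomial.modByMonic_eq_zero_iff_dvd (hm i)).2 (dvd_mul_right _ _)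
    simp [ℓ, Polynomial.modByMonicHom_apply, this]
  refine ⟨prodFunctional ℓ, ?_, ?_⟩
  · have h1 : ∀ i p, prodFunctional ℓ
        (p * (Polynomial.aeval (X i) (Polynomial.X * q i) : MvPolynomial ι R)) = 0 := by
      intro i p
      have : prodFunctional ℓ ∘ₗ (LinearMap.mulRight R
          (Polynomial.aeval (X i) (Polynomial.X * q i) : MvPolynomial ι R)) = 0 := by
        refine (basisMonomials ι R).ext fun m => ?_
        have h2 : (basisMonomials ι R m : MvPolynomial ι R) *
            Polynomial.aeval (X i) (Polynomial.X * q i) =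
            ∏ l, Polynomial.aeval (X l)
              (if l = i then Polynomial.X * q i * Polynomial.X ^ m l else Polynomial.X ^ m l) := by
          rw [coe_basisMonomials]
          dsimp only
          rw [monomial_eq, C_1, one_mul, Finsupp.prod_fintype _ _ (by simp),
            ← Finset.mul_prod_erase _ _ (Finset.mem_univ i),
            ← Finset.mul_prod_erase (a := i) (s := Finset.univ) (f := fun l =>
              (Polynomial.aeval (X l)) (if l = i then Polynomial.X * q i * Polynomial.X ^ m l else
                Polynomial.X ^ m l)) (Finset.mem_univ i), if_pos rfl]
          have : ∏ l ∈ Finset.univ.erase i, (Polynomial.aeval (X l : MvPolynomial ι R))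
              (if l = i then Polynomial.X * q i * Polynomial.X ^ m l else
                Polynomial.X ^ m l) = ∏ l ∈ Finset.univ.erase i, X l ^ m l :=
            Finset.prod_congr rfl fun l hl => by simp [Finset.ne_of_mem_erase hl]
          rw [this, map_mul _ _ (Polynomial.X ^ m i), map_pow, Polynomial.aeval_X]
          ring
        rw [LinearMap.comp_apply, LinearMap.mulRight_apply, h2, prodFunctional_prod,
          LinearMap.zero_apply]
        exact Finset.prod_eq_zero (Finset.mem_univ i) (by rw [if_pos rfl, hℓ])
      exact LinearMap.congr_fun this p
    intro x hx
    induction hx using Submodule.span_induction with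
    | mem x hx =>
      obtain ⟨i, rfl⟩ := hx
      simpa using h1 i 1
    | zero => exact map_zero _
    | add x y _ _ hx hy => rw [map_add, hx, hy, add_zero]
    | smul p x hx _ =>
      obtain ⟨b, rfl⟩ := (Submodule.mem_span_range_iff_exists_fun _).1 hx
      rw [Finset.smul_sum, map_sum]
      refine Finset.sum_eq_zero fun i _ => ?_
      rw [smul_eq_mul, smul_eq_mul, ← mul_assoc]
      exact h1 i _
  · rw [prodFunctional_prod]
    refine Finset.prod_eq_one fun i _ => ?_
    have h1 : q i %ₘ (Polynomial.X * q i) = q i := by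
      rw [Polynomial.modByMonic_eq_self_iff (hm i), mul_comm, Polynomial.degree_mul_X,
        Polynomial.degree_eq_natDegree (hq i).ne_zero]
      exact_mod_cast Nat.lt_succ_self _
    simp only [ℓ, LinearMap.comp_apply, Polynomial.modByMonicHom_apply, h1, Polynomial.lcoeff_apply]
    exact hq i

end Residue

open MvPolynomial

/-! ### Relations between polynomials vanishing at a point -/

section Bezout

theorem sub_C_eval_mem {σ R : Type*} [CommRing R] (a : σ → R) (p : MvPolynomial σ R) :
    p - C (eval a p) ∈ Ideal.span (Set.range fun i => (X i - C (a i) : MvPolynomial σ R)) := by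
  induction p using MvPolynomial.induction_on with
  | C r => simp
  | add p q hp hq =>
    convert add_mem hp hq using 1
    simp only [map_add]
    ring
  | mul_X p i hp =>
    have h : p * X i - C (eval a (p * X i)) =
        X i * (p - C (eval a p)) + C (eval a p) * (X i - C (a i)) := by
      simp only [map_mul, eval_X]
      ring
    rw [h]
    exact add_mem (Ideal.mul_mem_left _ _ hp)
      (Ideal.mul_mem_left _ _ (Ideal.subset_span ⟨i, rfl⟩))

/-- A polynomial in two sets of variables vanishing on the diagonal is a combination of the
differences of the variables. -/
theorem exists_bezout {σ R : Type*} [Fintype σ] [CommRing R] (p : MvPolynomial σ R) :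
    ∃ m : σ → MvPolynomial σ (MvPolynomial σ R),
      map C p - C p = ∑ i, m i * (X i - C (X i)) := by
  -- The outer variables are free and the inner ones serve as the point: evaluating `map C p` there
  -- returns `p`.
  have h := sub_C_eval_mem (R := MvPolynomial σ R) X (map C p)
  obtain ⟨m, hm⟩ := (Submodule.mem_span_range_iff_exists_fun _).1 h
  refine ⟨m, ?_⟩
  simp only [smul_eq_mul] at hm
  rw [hm, eval_map, eval₂_eta]

variable {σ O T : Type*} [CommRing O] [CommRing T] [Algebra O T]

/-- The coefficientwise extension of a linear form to polynomials. -/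
def coeffMap (φ : T →ₗ[O] O) (p : MvPolynomial σ T) : MvPolynomial σ O :=
  ∑ m ∈ p.support, monomial m (φ (coeff m p))

theorem coeff_coeffMap (φ : T →ₗ[O] O) (p : MvPolynomial σ T) (m : σ →₀ ℕ) :
    coeff m (coeffMap φ p) = φ (coeff m p) := by
  classical
  rw [coeffMap, coeff_sum]
  simp only [coeff_monomial, Finset.sum_ite_eq', mem_support_iff]
  split_ifs with h
  · rfl
  · rw [not_not.1 h, map_zero]

/-- This is `O[X]`-linearity, which lets `φ` carry syzygies with coefficients in `T[X]` to syzygies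
over `O[X]`. -/
theorem coeffMap_mul_map (φ : T →ₗ[O] O) (p : MvPolynomial σ T) (q : MvPolynomial σ O) :
    coeffMap φ (p * map (algebraMap O T) q) = coeffMap φ p * q := by
  classical
  ext m
  rw [coeff_coeffMap, coeff_mul, coeff_mul, map_sum]
  refine Finset.sum_congr rfl fun x _ => ?_
  rw [coeff_map, coeff_coeffMap, mul_comm, ← Algebra.smul_def, map_smul, smul_eq_mul, mul_comm]

theorem coeffMap_sum {ι : Type*} (s : Finset ι) (φ : T →ₗ[O] O) (p : ι → MvPolynomial σ T) :
    coeffMap φ (∑ j ∈ s, p j) = ∑ j ∈ s, coeffMap φ (p j) := by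
  ext m
  simp only [coeff_coeffMap, coeff_sum, map_sum]

/-- Every linear form on `T = O[X₁, …, Xₙ]/(f₀, …, fₙ)` gives rise to a relation between the `fⱼ`,
whose value at the origin is the value of the form at the signed minors of a matrix expressing the
`fⱼ` through the variables. -/
theorem exists_relation_of_form {n : ℕ} (t : Fin n → T)
    (f : Fin (n + 1) → MvPolynomial (Fin n) O) (hft : ∀ j, aeval t (f j) = 0)
    (hf : ∀ j, constantCoeff (f j) = 0) :
    ∃ N : Matrix (Fin (n + 1)) (Fin n) (MvPolynomial (Fin n) O),
      (∀ j, f j = ∑ i, N j i * X i) ∧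
      ∀ φ : T →ₗ[O] O, ∃ r : Fin (n + 1) → MvPolynomial (Fin n) O, ∑ j, r j * f j = 0 ∧
        ∀ j, constantCoeff (r j) = φ (aeval t (signedMinors N j)) := by
  choose m hm using fun j => exists_bezout (f j)
  refine ⟨Matrix.of fun j i => constantCoeff (m j i), fun j => ?_, fun φ => ?_⟩
  -- Putting the outer variables equal to `0` in the Bezout identity expresses `fⱼ` through the
  -- inner variables.
  · have h := congrArg constantCoeff (hm j)
    have h0 : constantCoeff (map C (f j) : MvPolynomial (Fin n) (MvPolynomial (Fin n) O)) = 0 := by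
      rw [constantCoeff_map, hf, map_zero]
    rw [map_sub, h0, constantCoeff_C, map_sum, zero_sub, neg_eq_iff_eq_neg,
      ← Finset.sum_neg_distrib] at h
    rw [h]
    refine Finset.sum_congr rfl fun i _ => ?_
    rw [map_mul, map_sub, constantCoeff_X, constantCoeff_C, Matrix.of_apply]
    ring
  -- Specializing the inner variables to `t` instead, where `fⱼ` vanishes, gives `fⱼ = ∑ Mⱼᵢ (Xᵢ -
  -- tᵢ)` over `T[X]`. The signed minors of `M` are then a syzygy of the `fⱼ`, to which `φ` is
  -- applied coefficientwise.
  · let M : Matrix (Fin (n + 1)) (Fin n) (MvPolynomial (Fin n) T) :=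
      Matrix.of fun j i => map (aeval t).toRingHom (m j i)
    have hM : ∀ j, map (algebraMap O T) (f j) = ∑ i, M j i * (X i - C (t i)) := by
      intro j
      have h := congrArg (map (aeval t).toRingHom) (hm j)
      rw [map_sub, map_map, map_C, map_sum] at h
      have e1 : (aeval t).toRingHom.comp C = algebraMap O T := by
        ext x
        simp
      have e2 : (aeval t).toRingHom (f j) = 0 := hft j
      rw [e1, e2, C_0, sub_zero] at h
      rw [h]
      refine Finset.sum_congr rfl fun i _ => ?_
      rw [map_mul, map_sub, map_X, map_C]
      congr 3
      simp
    refine ⟨fun j => coeffMap φ (signedMinors M j), ?_, fun j => ?_⟩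
    · simp only [← coeffMap_mul_map, ← coeffMap_sum]
      have : ∑ j, signedMinors M j * map (algebraMap O T) (f j) = 0 := by
        simp only [hM, Finset.mul_sum]
        rw [Finset.sum_comm]
        refine Finset.sum_eq_zero fun i _ => ?_
        simp only [← mul_assoc, ← Finset.sum_mul, signedMinors_vecMul, zero_mul]
      rw [this]
      simp [coeffMap]
    -- At the origin of the outer variables `M` becomes `N(t)`.
    · rw [constantCoeff_eq, coeff_coeffMap, ← constantCoeff_eq, map_signedMinors]
      have e := map_signedMinors (aeval t).toRingHom
        (Matrix.of fun j i => constantCoeff (m j i)) j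
      refine congrArg φ (Eq.trans ?_ e.symm)
      congr 1

end Bezout

/-! ### From syzygies to linear forms -/

section Form

variable {O T : Type*} [CommRing O] [CommRing T] [Algebra O T]

/-- The determinant of the relations between the `fⱼ` consisting of `r` and of expressions of
polynomials `hᵢ(Xᵢ)`, multiplied with a signed minor, is congruent modulo the `hᵢ(Xᵢ)`
to `rⱼ ∏ qᵢ(Xᵢ)`, where `hᵢ = Y qᵢ`. -/
theorem det_mul_signedMinors_sub_mem {n : ℕ} (f : Fin (n + 1) → MvPolynomial (Fin n) O)
    (N : Matrix (Fin (n + 1)) (Fin n) (MvPolynomial (Fin n) O))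
    (hN : ∀ j, f j = ∑ i, N j i * X i) (r : Fin (n + 1) → MvPolynomial (Fin n) O)
    (hr : ∑ j, r j * f j = 0) (q : Fin n → MvPolynomial (Fin n) O)
    (Q : Fin n → Fin (n + 1) → MvPolynomial (Fin n) O) (hQ : ∀ i, ∑ j, Q i j * f j = X i * q i)
    (j : Fin (n + 1)) :
    (Matrix.of (Fin.cons r Q) : Matrix (Fin (n + 1)) (Fin (n + 1)) _).det * signedMinors N j -
      r j * ∏ i, q i ∈ Ideal.span (Set.range fun i => X i * q i) := by
  set I := Ideal.span (Set.range fun i => X i * q i)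
  set P : Matrix (Fin (n + 1)) (Fin (n + 1)) (MvPolynomial (Fin n) O) :=
    Matrix.of (Fin.cons r Q)
  -- The matrix `G` has a zero row above `diag(q)`. Both `G` and `P N` express the vector `P f = (0,
  -- Xᵢ qᵢ)` through the variables, so their rows differ by relations of the variables, that is, by
  -- Koszul relations.
  let G : Matrix (Fin (n + 1)) (Fin n) (MvPolynomial (Fin n) O) :=
    Matrix.of (Fin.cons (0 : Fin n → MvPolynomial (Fin n) O) fun a b => Matrix.diagonal q a b :
      Fin (n + 1) → Fin n → MvPolynomial (Fin n) O)
  have hG : ∀ a, ∑ i, G a i * X i = (Fin.cons 0 (fun i => X i * q i) : Fin (n + 1) → _) a := by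
    intro a
    refine Fin.cases ?_ (fun a => ?_) a
    · simp [G]
    · simp only [G, Matrix.of_apply, Fin.cons_succ, Matrix.diagonal_apply, ite_mul, zero_mul,
        Finset.sum_ite_eq, Finset.mem_univ, if_true]
      ring
  have hPN : ∀ a, ∑ i, (P * N) a i * X i =
      (Fin.cons 0 (fun i => X i * q i) : Fin (n + 1) → _) a := by
    intro a
    have : ∑ i, (P * N) a i * X i = ∑ j, P a j * f j := by
      simp only [Matrix.mul_apply, Finset.sum_mul, hN, Finset.mul_sum, mul_assoc]
      rw [Finset.sum_comm]
    rw [this]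
    refine Fin.cases ?_ (fun a => ?_) a
    · simpa [P] using hr
    · simpa [P] using hQ a
  have hI : ∀ a, (Fin.cons 0 (fun i => X i * q i) : Fin (n + 1) → _) a ∈ I := by
    intro a
    refine Fin.cases ?_ (fun a => ?_) a
    · simp
    · rw [Fin.cons_succ]
      exact Ideal.subset_span ⟨a, rfl⟩
  have hminor : ∀ a, signedMinors (P * N) a - signedMinors G a ∈ I := by
    intro a
    rw [signedMinors, signedMinors, ← mul_sub]
    refine Ideal.mul_mem_left _ _ (det_sub_det_mem I _ _ X ?_ ?_ ?_)
    · intro b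
      exact (hPN (a.succAbove b)).symm ▸ hI _
    · intro b
      exact (hG (a.succAbove b)).symm ▸ hI _
    · intro b
      refine mem_koszulRelations_X _ ?_
      have h1 := hPN (a.succAbove b)
      rw [← hG (a.succAbove b), ← sub_eq_zero, ← Finset.sum_sub_distrib] at h1
      rw [← h1]
      refine Finset.sum_congr rfl fun i _ => ?_
      rw [Pi.sub_apply, sub_mul]
      rfl
  have hG0 : signedMinors G 0 = ∏ i, q i := by
    rw [signedMinors]
    have : G.submatrix (Fin.succAbove 0) id = Matrix.diagonal q := by
      ext a b
      simp [G]
    rw [this, Matrix.det_diagonal]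
    simp
  -- Every minor other than the `0`-th retains the zero row of `G`.
  have hGs : ∀ a : Fin n, signedMinors G a.succ = 0 := by
    intro a
    rw [signedMinors, Matrix.det_eq_zero_of_row_eq_zero (⟨0, a.pos⟩ : Fin n), mul_zero]
    intro b
    have : a.succ.succAbove (⟨0, a.pos⟩ : Fin n) = 0 := by
      obtain ⟨m, rfl⟩ := Nat.exists_eq_succ_of_ne_zero a.pos.ne'
      exact Fin.succ_succAbove_zero a
    simp [G, this]
  -- `Δⱼ(N)` is the determinant of `N` with the unit vector `eⱼ` as an extra column; multiplying
  -- that matrix by `P` transforms both parts.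
  have h1 : P.det * signedMinors N j = ∑ a, P a j * signedMinors (P * N) a := by
    have e : signedMinors N j = (addCol (Pi.single j 1) N).det := by
      simp [det_addCol, Pi.single_apply]
    rw [e, ← Matrix.det_mul, mul_addCol, det_addCol]
    simp
  have h2 : r j * ∏ i, q i = ∑ a, P a j * signedMinors G a := by
    rw [Fin.sum_univ_succ, hG0]
    simp [hGs, P]
  rw [h1, h2, ← Finset.sum_sub_distrib]
  refine sum_mem fun a _ => ?_
  rw [← mul_sub]
  exact Ideal.mul_mem_left _ _ (hminor a)

variable [Nontrivial O] [Algebra.IsIntegral O T]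

/-- Every relation between the `fⱼ` has, up to relations vanishing at the origin, the form
described in `exists_relation_of_form`. -/
theorem exists_form_of_relation {n : ℕ} (lam : T →ₐ[O] O) (t : Fin n → T)
    (ht : ∀ i, lam (t i) = 0) (hsurj : Function.Surjective (aeval (R := O) t))
    (f : Fin (n + 1) → MvPolynomial (Fin n) O)
    (hker : RingHom.ker (aeval (R := O) t) = Ideal.span (Set.range f))
    (N : Matrix (Fin (n + 1)) (Fin n) (MvPolynomial (Fin n) O))
    (hN : ∀ j, f j = ∑ i, N j i * X i) (r : Fin (n + 1) → MvPolynomial (Fin n) O)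
    (hr : ∑ j, r j * f j = 0) :
    ∃ φ : T →ₗ[O] O, ∀ j, φ (aeval t (signedMinors N j)) = constantCoeff (r j) := by
  -- An integral equation of `tᵢ` has constant term `0`, since `λ(tᵢ) = 0`; hence it is divisible by
  -- the variable.
  have hint : ∀ i, ∃ q : Polynomial O, q.Monic ∧ Polynomial.aeval (t i) (Polynomial.X * q) = 0 := by
    intro i
    obtain ⟨h, hm, h0⟩ := Algebra.IsIntegral.isIntegral (R := O) (t i)
    have h1 : h.coeff 0 = 0 := by
      have := congrArg lam (show Polynomial.aeval (t i) h = 0 from h0)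
      rw [← Polynomial.aeval_algHom_apply, ht, map_zero, Polynomial.aeval_def,
        Polynomial.eval₂_at_zero] at this
      exact this
    obtain ⟨q, rfl⟩ := Polynomial.X_dvd_iff.2 h1
    exact ⟨q, Polynomial.Monic.of_mul_monic_left Polynomial.monic_X hm, h0⟩
  choose q hq hqt using hint
  let q' : Fin n → MvPolynomial (Fin n) O := fun i => Polynomial.aeval (X i) (q i)
  have hX : ∀ i, Polynomial.aeval (X i) (Polynomial.X * q i) = X i * q' i := by
    intro i
    simp [q']
  have hQ : ∀ i, ∃ Q : Fin (n + 1) → MvPolynomial (Fin n) O, ∑ j, Q j * f j = X i * q' i := by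
    intro i
    have h : X i * q' i ∈ RingHom.ker (aeval (R := O) t) := by
      rw [RingHom.mem_ker, ← hX, ← Polynomial.aeval_algHom_apply, aeval_X, hqt]
    rw [hker] at h
    exact (Submodule.mem_span_range_iff_exists_fun _).1 h
  choose Q hQ using hQ
  obtain ⟨τ, hτ, hτ1⟩ := exists_residue q hq
  simp only [hX] at hτ
  set I := Ideal.span (Set.range fun i => X i * q' i)
  set P : Matrix (Fin (n + 1)) (Fin (n + 1)) (MvPolynomial (Fin n) O) :=
    Matrix.of (Fin.cons r Q)
  -- Multiply `P f = (0, Xᵢ qᵢ)` by the adjugate of `P`. It follows that `p ↦ τ(det P · p)` kills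
  -- the `fⱼ` and descends to `T`.
  have hPf : ∀ j, P.det * f j ∈ I := by
    intro j
    have h1 : P.mulVec f = Fin.cons 0 fun i => X i * q' i := by
      ext1 a
      refine Fin.cases ?_ (fun a => ?_) a
      · simpa [P, Matrix.mulVec, dotProduct] using hr
      · simpa [P, Matrix.mulVec, dotProduct] using hQ a
    have h2 : P.adjugate.mulVec (P.mulVec f) = P.det • f := by
      rw [Matrix.mulVec_mulVec, Matrix.adjugate_mul, Matrix.smul_mulVec, Matrix.one_mulVec]
    have h3 := congrFun h2 j
    rw [Pi.smul_apply, smul_eq_mul] at h3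
    rw [← h3, h1, Matrix.mulVec, dotProduct, Fin.sum_univ_succ, Fin.cons_zero, mul_zero, zero_add]
    exact sum_mem fun i _ => Ideal.mul_mem_left _ _ (Ideal.subset_span ⟨i, rfl⟩)
  let ψ : MvPolynomial (Fin n) O →ₗ[O] O := τ ∘ₗ LinearMap.mulLeft O P.det
  have hψ : ∀ p, aeval t p = 0 → ψ p = 0 := by
    intro p hp
    have h1 : p ∈ Ideal.span (Set.range f) := hker ▸ hp
    obtain ⟨b, rfl⟩ := (Submodule.mem_span_range_iff_exists_fun _).1 h1
    refine hτ _ ?_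
    rw [LinearMap.mulLeft_apply, Finset.mul_sum]
    refine sum_mem fun j _ => ?_
    rw [smul_eq_mul, mul_left_comm]
    exact Ideal.mul_mem_left _ _ (hPf j)
  let e := (aeval (R := O) t).toLinearMap.quotKerEquivOfSurjective hsurj
  have hle : LinearMap.ker (aeval (R := O) t).toLinearMap ≤ LinearMap.ker ψ := fun p hp => hψ p hp
  refine ⟨(LinearMap.ker (aeval (R := O) t).toLinearMap).liftQ ψ hle ∘ₗ
    e.symm.toLinearMap, fun j => ?_⟩
  have he : e.symm (aeval t (signedMinors N j)) = Submodule.Quotient.mk (signedMinors N j) :=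
    (LinearEquiv.symm_apply_eq _).2 rfl
  rw [LinearMap.comp_apply, LinearEquiv.coe_coe, he, Submodule.liftQ_apply]
  -- Only the constant term of `rⱼ` matters, because `Xᵢ ∏ qₗ` is a multiple of `Xᵢ qᵢ`. Since `τ(∏
  -- qᵢ) = 1`, the form takes the value `rⱼ(0)`.
  have h1 : P.det * signedMinors N j - C (constantCoeff (r j)) * ∏ i, q' i ∈ I := by
    have h2 : r j - C (constantCoeff (r j)) ∈
        Ideal.span (Set.range (X : Fin n → MvPolynomial (Fin n) O)) := by
      have := sub_C_eval_mem (0 : Fin n → O) (r j)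
      simpa [eval_zero] using this
    have h3 : (r j - C (constantCoeff (r j))) * ∏ i, q' i ∈ I := by
      obtain ⟨b, hb⟩ := (Submodule.mem_span_range_iff_exists_fun _).1 h2
      rw [← hb, Finset.sum_mul]
      refine sum_mem fun i _ => ?_
      rw [← Finset.mul_prod_erase _ _ (Finset.mem_univ i), smul_eq_mul,
        show b i * X i * (q' i * ∏ l ∈ Finset.univ.erase i, q' l) =
          (b i * ∏ l ∈ Finset.univ.erase i, q' l) * (X i * q' i) by ring]
      exact Ideal.mul_mem_left _ _ (Ideal.subset_span ⟨i, rfl⟩)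
    convert add_mem (det_mul_signedMinors_sub_mem f N hN r hr q' Q hQ j) h3 using 1
    ring
  have h2 := hτ _ h1
  rw [map_sub, ← smul_eq_C_mul, map_smul, hτ1, smul_eq_mul, mul_one, sub_eq_zero] at h2
  exact h2

end Form

/-! ### The augmentation ideal of a polynomial ring -/

section Vars

variable {ι R : Type*} [CommRing R]

theorem mem_idealOfVars_iff (p : MvPolynomial ι R) :
    p ∈ idealOfVars ι R ↔ constantCoeff p = 0 := by
  refine ⟨fun h => ?_, fun h => ?_⟩
  · have h1 : idealOfVars ι R ≤ RingHom.ker (constantCoeff (σ := ι) (R := R)) := by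
      rw [idealOfVars, Ideal.span_le]
      rintro _ ⟨i, rfl⟩
      exact constantCoeff_X _ i
    exact h1 h
  · have := sub_C_eval_mem (0 : ι → R) p
    simpa [eval_zero, h] using this

theorem X_mem_idealOfVars (i : ι) : (X i : MvPolynomial ι R) ∈ idealOfVars ι R :=
  Ideal.subset_span ⟨i, rfl⟩

variable [Fintype ι]

theorem mem_idealOfVars_iff_exists (p : MvPolynomial ι R) :
    p ∈ idealOfVars ι R ↔ ∃ a : ι → MvPolynomial ι R, ∑ i, a i * X i = p :=
  Submodule.mem_span_range_iff_exists_fun _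

theorem coeff_single_sum_mul_X (a : ι → MvPolynomial ι R) (l : ι) :
    coeff (Finsupp.single l 1) (∑ i, a i * X i) = constantCoeff (a l) := by
  classical
  rw [coeff_sum, Finset.sum_eq_single l]
  · rw [coeff_mul_X', if_pos (by simp), tsub_self, constantCoeff_eq]
  · intro i _ hi
    rw [coeff_mul_X', if_neg]
    simpa [Finsupp.single_apply] using hi
  · simp

theorem sum_mul_X_mem_sq_iff (a : ι → MvPolynomial ι R) :
    ∑ i, a i * X i ∈ idealOfVars ι R ^ 2 ↔ ∀ i, constantCoeff (a i) = 0 := by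
  refine ⟨fun h i => ?_, fun h => sum_mem fun i _ => ?_⟩
  · rw [← coeff_single_sum_mul_X a i]
    exact (mem_pow_idealOfVars_iff' 2 _).1 h _ (by simp)
  · rw [pow_two]
    exact Ideal.mul_mem_mul ((mem_idealOfVars_iff _).2 (h i)) (X_mem_idealOfVars i)

end Vars

section Ker

variable {O T : Type*} [CommRing O] [CommRing T] [Algebra O T] {n : ℕ} (lam : T →ₐ[O] O)
  (t : Fin n → T)

theorem apply_aeval (ht : ∀ i, lam (t i) = 0) (p : MvPolynomial (Fin n) O) :
    lam (aeval t p) = constantCoeff p := by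
  have : lam.comp (aeval t) = aeval (0 : Fin n → O) := by
    ext i
    simp [ht]
  rw [← AlgHom.comp_apply, this, aeval_zero]
  rfl

theorem mem_ker_pow_iff (ht : ∀ i, lam (t i) = 0)
    (hsurj : Function.Surjective (aeval (R := O) t)) (k : ℕ) (x : T) :
    x ∈ RingHom.ker lam ^ k ↔ ∃ p ∈ idealOfVars (Fin n) O ^ k, aeval t p = x := by
  have h : RingHom.ker lam = Ideal.map (aeval (R := O) t) (idealOfVars (Fin n) O) := by
    ext y
    rw [Ideal.mem_map_iff_of_surjective _ hsurj]
    refine ⟨fun hy => ?_, ?_⟩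
    · obtain ⟨p, rfl⟩ := hsurj y
      refine ⟨p, (mem_idealOfVars_iff p).2 ?_, rfl⟩
      rw [← apply_aeval lam t ht]
      exact hy
    · rintro ⟨p, hp, rfl⟩
      rw [RingHom.mem_ker, apply_aeval lam t ht]
      exact (mem_idealOfVars_iff p).1 hp
  rw [h, ← Ideal.map_pow, Ideal.mem_map_iff_of_surjective _ hsurj]

end Ker

/-! ### Linear algebra over domains and discrete valuation rings -/

section LinearAlgebra

variable {O : Type*} [CommRing O] [IsDomain O] {n : ℕ}

/-- If all minors vanished, `B` would be injective; then `B (b - N B) = 0` would force `N B = b` in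
size `n + 1`, against `B N = b` in size `n`. -/
theorem signedMinors_ne_zero (N : Matrix (Fin (n + 1)) (Fin n) O)
    (B : Matrix (Fin n) (Fin (n + 1)) O) (b : O) (hb : b ≠ 0) (h : B * N = b • 1) :
    signedMinors N ≠ 0 := by
  intro h0
  have h1 : ∀ v : Fin (n + 1) → O, B.mulVec v = 0 → v = 0 := by
    intro v hv
    ext j
    -- For `B v = 0`, bordering `B` by `eⱼ` makes `det (P * addCol v N) = vⱼ bⁿ`, while vanishing
    -- minors make it `0`.
    let P : Matrix (Fin (n + 1)) (Fin (n + 1)) O :=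
      Matrix.of (Fin.cons (Pi.single j (1 : O)) fun i => B i : Fin (n + 1) → Fin (n + 1) → O)
    have h2 : (P * addCol v N).det = 0 := by simp [Matrix.det_mul, det_addCol, h0]
    have h3 : P.mulVec v = Pi.single 0 (v j) := by
      ext1 a
      refine Fin.cases ?_ (fun a => ?_) a
      · simp [P, Matrix.mulVec, dotProduct, Pi.single_apply]
      · have := congrFun hv a
        simpa [P, Matrix.mulVec, dotProduct] using this
    have h4 : (P * N).submatrix (Fin.succAbove 0) id = b • 1 := by
      rw [← h]
      ext a c
      simp [P, Matrix.mul_apply]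
    have h5 : signedMinors (P * N) 0 = b ^ n := by
      rw [signedMinors, h4]
      simp
    rw [mul_addCol, h3, det_addCol, Fin.sum_univ_succ, Pi.single_eq_same, h5] at h2
    simpa [pow_ne_zero n hb] using h2
  have h2 : (b • 1 - N * B : Matrix (Fin (n + 1)) (Fin (n + 1)) O) = 0 := by
    ext i j
    refine congrFun (h1 (fun i => (b • 1 - N * B : Matrix (Fin (n + 1)) (Fin (n + 1)) O) i j) ?_) i
    have h3 : B * (b • 1 - N * B) = 0 := by
      rw [Matrix.mul_sub, ← Matrix.mul_assoc, h]
      simp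
    ext k
    exact congrFun (congrFun h3 k) j
  -- Comparing traces gives `(n + 1) b = n b`.
  have h3 := congrArg Matrix.trace h2
  rw [Matrix.trace_sub, Matrix.trace_mul_comm, h] at h3
  simp only [Matrix.trace_smul, Matrix.trace_one, Fintype.card_fin, Matrix.trace_zero,
    smul_eq_mul] at h3
  apply hb
  push_cast at h3
  linear_combination h3

theorem exists_dvd_all [IsDiscreteValuationRing O] (D : Fin (n + 1) → O) :
    ∃ k, ∀ j, D k ∣ D j := by
  obtain ⟨k, hk⟩ := Finite.exists_min fun j => IsDiscreteValuationRing.addVal O (D j)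
  exact ⟨k, fun j => IsDiscreteValuationRing.addVal_le_iff_dvd.1 (hk j)⟩

/-- The left kernel of a matrix with nonzero maximal minor. -/
theorem exists_smul_of_vecMul_eq_zero (N : Matrix (Fin (n + 1)) (Fin n) O) (c : Fin (n + 1) → O)
    (k : Fin (n + 1)) (hk : signedMinors N k ≠ 0) (hck : c k = 1)
    (hc : ∀ i, ∑ j, c j * N j i = 0) (v : Fin (n + 1) → O) (hv : ∀ i, ∑ j, v j * N j i = 0) :
    ∀ j, v j = v k * c j := by
  have h1 : ∀ i, ∑ j, (v j - v k * c j) * N j i = 0 := by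
    intro i
    simp only [sub_mul, Finset.sum_sub_distrib, hv, mul_assoc, ← Finset.mul_sum, hc, mul_zero,
      sub_zero]
  have h2 : ∀ i, ∑ j : Fin n, (N.submatrix k.succAbove id).transpose i j *
      (v (k.succAbove j) - v k * c (k.succAbove j)) = 0 := by
    intro i
    have := h1 i
    rw [Fin.sum_univ_succAbove _ k, hck, mul_one, sub_self, zero_mul, zero_add] at this
    rw [← this]
    exact Finset.sum_congr rfl fun j _ => mul_comm _ _
  have h3 : (N.submatrix k.succAbove id).transpose.det ≠ 0 := by
    rw [Matrix.det_transpose]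
    intro h
    exact hk (by rw [signedMinors, h, mul_zero])
  intro j
  by_cases hj : j = k
  · rw [hj, hck, mul_one]
  · obtain ⟨l, rfl⟩ := Fin.exists_succAbove_eq hj
    have := det_mul_eq_zero_of_mulVec _ _ h2 l
    exact sub_eq_zero.1 ((mul_eq_zero.1 this).resolve_left h3)

/-- An element of a finite module over a PID on which all linear forms are divisible by `w` is
divisible by `w` up to torsion. -/
theorem exists_smul_add_torsion [IsPrincipalIdealRing O] {M : Type*} [AddCommGroup M] [Module O M]
    [Module.Finite O M] (w : O) (x : M) (h : ∀ φ : M →ₗ[O] O, w ∣ φ x) :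
    ∃ y, x - w • y ∈ Submodule.torsion O M := by
  have : Module.Free O (M ⧸ Submodule.torsion O M) := Module.free_of_finite_type_torsion_free'
  let b := Module.Free.chooseBasis O (M ⧸ Submodule.torsion O M)
  choose a ha using fun i => h (b.coord i ∘ₗ (Submodule.torsion O M).mkQ)
  obtain ⟨y, hy⟩ := (Submodule.torsion O M).mkQ_surjective (∑ i, a i • b i)
  refine ⟨y, (Submodule.Quotient.eq _).1 ?_⟩
  have h1 := b.sum_repr ((Submodule.torsion O M).mkQ x)
  rw [Submodule.Quotient.mk_smul]
  change (Submodule.torsion O M).mkQ x = w • (Submodule.torsion O M).mkQ y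
  rw [hy, ← h1, Finset.smul_sum]
  refine Finset.sum_congr rfl fun i _ => ?_
  rw [smul_smul, ← ha i]
  rfl

end LinearAlgebra

/-! ### Algebras with one more relation than variables -/

/-- `T = O[X₁, …, Xₙ]/(f₀, …, fₙ)` by means of `Xᵢ ↦ tᵢ ∈ ker λ`. -/
structure IsPresentation {O T : Type*} [CommRing O] [CommRing T] [Algebra O T] (lam : T →ₐ[O] O)
    {n : ℕ} (t : Fin n → T) (f : Fin (n + 1) → MvPolynomial (Fin n) O) : Prop where
  apply_eq_zero : ∀ i, lam (t i) = 0
  surjective : Function.Surjective (aeval (R := O) t)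
  ker_eq : RingHom.ker (aeval (R := O) t) = Ideal.span (Set.range f)

section Core

variable {O T : Type*} [CommRing O] [CommRing T] [Algebra O T] {lam : T →ₐ[O] O} {n : ℕ}
  {t : Fin n → T} {f : Fin (n + 1) → MvPolynomial (Fin n) O}

theorem IsPresentation.mem_ker_iff (hP : IsPresentation lam t f) (p : MvPolynomial (Fin n) O) :
    aeval t p = 0 ↔ ∃ a : Fin (n + 1) → MvPolynomial (Fin n) O, ∑ j, a j * f j = p := by
  rw [← RingHom.mem_ker, hP.ker_eq]
  exact Submodule.mem_span_range_iff_exists_fun _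

theorem IsPresentation.aeval_eq_zero (hP : IsPresentation lam t f) (j : Fin (n + 1)) :
    aeval t (f j) = 0 := by
  rw [← RingHom.mem_ker, hP.ker_eq]
  exact Ideal.subset_span ⟨j, rfl⟩

theorem IsPresentation.mem_mul_ker_iff (hP : IsPresentation lam t f)
    (p : MvPolynomial (Fin n) O) :
    p ∈ idealOfVars (Fin n) O * RingHom.ker (aeval (R := O) t) ↔
      ∃ a : Fin (n + 1) → MvPolynomial (Fin n) O,
        (∀ j, constantCoeff (a j) = 0) ∧ ∑ j, a j * f j = p := by
  rw [hP.ker_eq, ← smul_eq_mul, Ideal.span, Submodule.mem_ideal_smul_span_iff_exists_sum]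
  constructor
  · rintro ⟨a, ha, rfl⟩
    refine ⟨a, fun j => (mem_idealOfVars_iff _).1 (ha j), ?_⟩
    rw [Finsupp.sum_fintype _ _ (by simp)]
    simp
  · rintro ⟨a, ha, rfl⟩
    refine ⟨Finsupp.equivFunOnFinite.symm a, fun j => (mem_idealOfVars_iff _).2 (ha j), ?_⟩
    rw [Finsupp.sum_fintype _ _ (by simp)]
    simp

variable {N : Matrix (Fin (n + 1)) (Fin n) (MvPolynomial (Fin n) O)}

/-- The linear part of `∑ aⱼ fⱼ` is the row vector `a(0) N(0)`. -/
theorem sum_mul_mem_sq_iff (hN : ∀ j, f j = ∑ i, N j i * X i)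
    (a : Fin (n + 1) → MvPolynomial (Fin n) O) :
    ∑ j, a j * f j ∈ idealOfVars (Fin n) O ^ 2 ↔
      ∀ i, ∑ j, constantCoeff (a j) * constantCoeff (N j i) = 0 := by
  have h : ∑ j, a j * f j = ∑ i, (∑ j, a j * N j i) * X i := by
    simp only [hN, Finset.mul_sum, Finset.sum_mul, mul_assoc]
    rw [Finset.sum_comm]
  rw [h, sum_mul_X_mem_sq_iff]
  simp

/-- In effect `C₁` is the cokernel of `N(0)`: the image of a polynomial without constant term dies
in it exactly when its linear part is a combination of rows of `N(0)`. -/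
theorem IsPresentation.aeval_mem_sq_iff (hP : IsPresentation lam t f)
    (hN : ∀ j, f j = ∑ i, N j i * X i) (a : Fin n → MvPolynomial (Fin n) O) :
    aeval t (∑ i, a i * X i) ∈ RingHom.ker lam ^ 2 ↔ ∃ v : Fin (n + 1) → O,
      ∀ i, constantCoeff (a i) = ∑ j, v j * constantCoeff (N j i) := by
  rw [mem_ker_pow_iff lam t hP.apply_eq_zero hP.surjective]
  have h : ∀ v : Fin (n + 1) → MvPolynomial (Fin n) O, ∑ i, a i * X i - ∑ j, v j * f j =
      ∑ i, (a i - ∑ j, v j * N j i) * X i := by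
    intro v
    simp only [hN, sub_mul, Finset.sum_sub_distrib, Finset.mul_sum, Finset.sum_mul, mul_assoc]
    rw [Finset.sum_comm (s := Finset.univ (α := Fin n))]
  constructor
  · rintro ⟨p, hp, hpa⟩
    rw [← sub_eq_zero, ← map_sub] at hpa
    obtain ⟨v, hv⟩ := (hP.mem_ker_iff _).1 hpa
    refine ⟨fun j => - constantCoeff (v j), fun i => ?_⟩
    have h1 : ∑ i, (a i - ∑ j, (- v j) * N j i) * X i ∈ idealOfVars (Fin n) O ^ 2 := by
      rw [← h fun j => - v j]
      convert hp using 1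
      simp [hv]
    have h2 := (sum_mul_X_mem_sq_iff _).1 h1 i
    rw [map_sub, sub_eq_zero, map_sum] at h2
    rw [h2]
    simp
  · rintro ⟨v, hv⟩
    refine ⟨∑ i, a i * X i - ∑ j, C (v j) * f j, ?_, ?_⟩
    · rw [h, sum_mul_X_mem_sq_iff]
      intro i
      simp [hv]
    · rw [map_sub, sub_eq_self, map_sum]
      exact Finset.sum_eq_zero fun j _ => by rw [map_mul, hP.aeval_eq_zero, mul_zero]

/-- Since `c k = 1`, the relation `c` between the rows of `N(0)` makes row `k` redundant. Dropping
it leaves a square presentation of `C₁`. -/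
theorem IsPresentation.fittingIdeal_cotangent [IsDomain O] (hP : IsPresentation lam t f)
    (hN : ∀ j, f j = ∑ i, N j i * X i) (k : Fin (n + 1)) (c : Fin (n + 1) → O) (hck : c k = 1)
    (hc : ∀ i, ∑ j, c j * constantCoeff (N j i) = 0) :
    fittingIdeal O (C1 lam) = Ideal.span {signedMinors (N.map constantCoeff) k} := by
  have htm : ∀ i, t i ∈ RingHom.ker lam := hP.apply_eq_zero
  let e : Fin n → C1 lam := fun i => (RingHom.ker lam).toCotangent ⟨t i, htm i⟩
  have he : ∀ v : Fin n → O, ∑ i, v i • e i = 0 ↔ ∃ u : Fin (n + 1) → O,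
      ∀ i, v i = ∑ j, u j * constantCoeff (N j i) := by
    intro v
    have h1 : ∑ i, v i • e i = (RingHom.ker lam).toCotangent
        (∑ i, (algebraMap O T (v i)) • ⟨t i, htm i⟩) := by
      rw [map_sum]
      refine Finset.sum_congr rfl fun i _ => ?_
      rw [map_smul, algebraMap_smul]
    rw [h1, Ideal.toCotangent_eq_zero]
    have h2 : ((∑ i, (algebraMap O T (v i)) • ⟨t i, htm i⟩ : RingHom.ker lam) : T) =
        aeval t (∑ i, C (v i) * X i) := by
      simp [Algebra.smul_def]
    rw [h2, hP.aeval_mem_sq_iff hN]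
    simp
  have hspan : Submodule.span O (Set.range e) = ⊤ := by
    rw [eq_top_iff]
    intro x _
    obtain ⟨⟨y, hy⟩, rfl⟩ := (RingHom.ker lam).toCotangent_surjective x
    obtain ⟨p, hp, rfl⟩ := (mem_ker_pow_iff lam t hP.apply_eq_zero hP.surjective 1 y).1
      (by rwa [pow_one])
    rw [pow_one] at hp
    obtain ⟨a, rfl⟩ := (mem_idealOfVars_iff_exists p).1 hp
    have h1 : (RingHom.ker lam).toCotangent ⟨aeval t (∑ i, a i * X i), hy⟩ =
        ∑ i, constantCoeff (a i) • e i := by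
      have h2 : ∑ i, constantCoeff (a i) • e i = (RingHom.ker lam).toCotangent
          (∑ i, (algebraMap O T (constantCoeff (a i))) • ⟨t i, htm i⟩) := by
        rw [map_sum]
        refine Finset.sum_congr rfl fun i _ => ?_
        rw [map_smul, algebraMap_smul]
      rw [h2, Ideal.toCotangent_eq]
      have h3 : aeval t (∑ i, a i * X i) -
          ((∑ i, (algebraMap O T (constantCoeff (a i))) • ⟨t i, htm i⟩ : RingHom.ker lam) : T) =
          aeval t (∑ i, (a i - C (constantCoeff (a i))) * X i) := by
        simp [sub_mul, Finset.sum_sub_distrib, Algebra.smul_def]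
      change aeval t (∑ i, a i * X i) - _ ∈ _
      rw [h3, hP.aeval_mem_sq_iff hN]
      exact ⟨0, by simp⟩
    rw [h1]
    exact sum_mem fun i _ => Submodule.smul_mem _ _ (Submodule.subset_span ⟨i, rfl⟩)
  have h := fittingIdeal_eq_span_det e hspan
    ((N.map constantCoeff).submatrix k.succAbove id) (fun a => (he _).2
      ⟨Pi.single (k.succAbove a) 1, fun i => by simp [Pi.single_apply]⟩) (fun v hv => by
      obtain ⟨u, hu⟩ := (he v).1 hv
      refine ⟨fun a => u (k.succAbove a) - u k * c (k.succAbove a), funext fun i => ?_⟩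
      have h1 : v i = ∑ j, (u j - u k * c j) * constantCoeff (N j i) := by
        simp only [sub_mul, Finset.sum_sub_distrib, mul_assoc, ← Finset.mul_sum, hc, mul_zero,
          sub_zero, hu]
      rw [h1, Fin.sum_univ_succAbove _ k, hck, mul_one, sub_self, zero_mul, zero_add]
      rfl)
  rw [h, Ideal.span_singleton_eq_span_singleton, signedMinors]
  exact ((associated_isUnit_mul_left_iff ((isUnit_one.neg).pow _)).2 (Associated.refl _)).symm

/-- As `b` kills `C₁`, each `b tᵢ` is a consequence of the rows of `N(0)`, that is, `B N(0) = b` for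
some `B`. -/
theorem IsPresentation.signedMinors_ne_zero [IsDomain O] (hP : IsPresentation lam t f)
    (hN : ∀ j, f j = ∑ i, N j i * X i) (b : O) (hb0 : b ≠ 0)
    (hb : ∀ p ∈ RingHom.ker lam, b • p ∈ RingHom.ker lam ^ 2) :
    signedMinors (N.map constantCoeff) ≠ 0 := by
  have h1 : ∀ i, ∃ v : Fin (n + 1) → O, ∀ l, (if l = i then b else 0) =
      ∑ j, v j * constantCoeff (N j l) := by
    intro i
    have h2 : aeval t (∑ l, C (if l = i then b else 0) * X l : MvPolynomial (Fin n) O) ∈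
        RingHom.ker lam ^ 2 := by
      convert hb (t i) (hP.apply_eq_zero i) using 1
      simp [apply_ite C, Algebra.smul_def, ite_mul]
    simpa using (hP.aeval_mem_sq_iff hN _).1 h2
  choose B hB using h1
  refine WilesDefect.signedMinors_ne_zero _ (Matrix.of B) b hb0 ?_
  ext i l
  simp only [Matrix.mul_apply, Matrix.of_apply, Matrix.map_apply, ← hB, Matrix.smul_apply,
    Matrix.one_apply, smul_eq_mul, mul_ite, mul_one, mul_zero, eq_comm]

/-- From `N(t) t = f(t) = 0`, Cramer's rule shows that the minors of `N(t)` kill every `tᵢ`, and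
these generate `ker λ`. -/
theorem IsPresentation.mul_signedMinors_mem_torsion (hP : IsPresentation lam t f)
    (hN : ∀ j, f j = ∑ i, N j i * X i) (k : Fin (n + 1)) (p : T) (hp : p ∈ RingHom.ker lam) :
    p * aeval t (signedMinors N k) = 0 := by
  have h1 : ∀ i, aeval t (signedMinors N k) * t i = 0 := by
    intro i
    have e : aeval t (signedMinors N k) = signedMinors (N.map (aeval t).toRingHom) k :=
      map_signedMinors (aeval t).toRingHom N k
    rw [e]
    refine signedMinors_mul_eq_zero _ t (fun j => ?_) k i
    rw [← hP.aeval_eq_zero j, hN j, map_sum]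
    simp
  obtain ⟨q, hq, rfl⟩ := (mem_ker_pow_iff lam t hP.apply_eq_zero hP.surjective 1 p).1
    (by rwa [pow_one])
  rw [pow_one] at hq
  obtain ⟨a, rfl⟩ := (mem_idealOfVars_iff_exists q).1 hq
  rw [map_sum, Finset.sum_mul]
  refine Finset.sum_eq_zero fun i _ => ?_
  rw [map_mul, aeval_X, mul_assoc, mul_comm (t i), h1, mul_zero]

/-- The invariants of an algebra with one more relation than variables. -/
theorem IsPresentation.exists_invariants [IsDomain O] [IsDiscreteValuationRing O] [Module.Finite O T]
    (hP : IsPresentation lam t f) (b : O) (hb0 : b ≠ 0)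
    (hb : ∀ p ∈ RingHom.ker lam, b • p ∈ RingHom.ker lam ^ 2) :
    ∃ w δ : O, δ ≠ 0 ∧ fittingIdeal O (C1 lam) = Ideal.span {δ * w} ∧
      (∃ x₀ : MvPolynomial (Fin n) O, aeval t x₀ = 0 ∧ x₀ ∈ idealOfVars (Fin n) O ^ 2 ∧
        (∀ x, aeval t x = 0 → x ∈ idealOfVars (Fin n) O ^ 2 → ∃ a : O,
          x - C a * x₀ ∈ idealOfVars (Fin n) O * RingHom.ker (aeval (R := O) t)) ∧
        ∀ a : O, C a * x₀ ∈ idealOfVars (Fin n) O * RingHom.ker (aeval (R := O) t) ↔ w ∣ a) ∧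
      ∀ a : O, (∃ s, lam s = a ∧ ∀ p ∈ RingHom.ker lam, p * s ∈ Submodule.torsion O T) ↔
        δ ∣ a := by
  obtain ⟨N, hN, hform⟩ := exists_relation_of_form t f hP.aeval_eq_zero fun j => by
    rw [← apply_aeval lam t hP.apply_eq_zero, hP.aeval_eq_zero, map_zero]
  set D := signedMinors (N.map constantCoeff) with hD
  have hlamD : ∀ j, lam (aeval t (signedMinors N j)) = D j := fun j => by
    rw [apply_aeval lam t hP.apply_eq_zero, map_signedMinors]
  have hD0 : D ≠ 0 := hP.signedMinors_ne_zero hN b hb0 hb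
  obtain ⟨k, hk⟩ := exists_dvd_all D
  have hDk : D k ≠ 0 := fun h => hD0 (funext fun j => by
    obtain ⟨x, hx⟩ := hk j
    rw [hx, h, zero_mul, Pi.zero_apply])
  choose c hDc using hk
  have hck : c k = 1 := mul_left_cancel₀ hDk (by rw [← hDc, mul_one])
  have hc : ∀ i, ∑ j, c j * constantCoeff (N j i) = 0 := by
    intro i
    have h := signedMinors_vecMul (N.map constantCoeff) i
    rw [← hD] at h
    refine mul_left_cancel₀ hDk ?_
    rw [mul_zero, ← h, Finset.mul_sum]
    refine Finset.sum_congr rfl fun j _ => ?_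
    rw [← mul_assoc, ← hDc]
    rfl
  have hcker : ∀ v : Fin (n + 1) → O, (∀ i, ∑ j, v j * constantCoeff (N j i) = 0) →
      ∀ j, v j = v k * c j := fun v hv =>
    exists_smul_of_vecMul_eq_zero (N.map constantCoeff) c k hDk hck hc v hv
  -- The scalars `a` for which `a c` is the constant term of a syzygy. Every syzygy has a constant
  -- term of this shape, since it kills `N(0)`.
  let L : Ideal O :=
    { carrier := {a | ∃ r : Fin (n + 1) → MvPolynomial (Fin n) O, ∑ j, r j * f j = 0 ∧
        ∀ j, constantCoeff (r j) = a * c j}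
      add_mem' := by
        rintro a a' ⟨r, hr, hr'⟩ ⟨s, hs, hs'⟩
        refine ⟨r + s, ?_, fun j => ?_⟩
        · simp only [Pi.add_apply, add_mul, Finset.sum_add_distrib, hr, hs, add_zero]
        · rw [Pi.add_apply, map_add, hr', hs', add_mul]
      zero_mem' := ⟨0, by simp, by simp⟩
      smul_mem' := by
        rintro a a' ⟨r, hr, hr'⟩
        refine ⟨fun j => C a * r j, ?_, fun j => ?_⟩
        · simp only [mul_assoc, ← Finset.mul_sum, hr, mul_zero]
        · rw [map_mul, constantCoeff_C, hr', smul_eq_mul, mul_assoc] }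
  obtain ⟨w, hw⟩ := IsPrincipalIdealRing.principal L
  have hLw : ∀ a, a ∈ L ↔ w ∣ a := fun a => by
    rw [hw]
    exact Ideal.mem_span_singleton
  have hLr : ∀ r : Fin (n + 1) → MvPolynomial (Fin n) O, ∑ j, r j * f j = 0 →
      (∀ j, constantCoeff (r j) = constantCoeff (r k) * c j) ∧ constantCoeff (r k) ∈ L := by
    intro r hr
    have h1 : ∀ j, constantCoeff (r j) = constantCoeff (r k) * c j :=
      hcker (fun j => constantCoeff (r j))
        ((sum_mul_mem_sq_iff hN r).1 (hr ▸ Submodule.zero_mem _))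
    exact ⟨h1, r, hr, h1⟩
  have hform' : ∀ φ : T →ₗ[O] O, w ∣ φ (aeval t (signedMinors N k)) := by
    intro φ
    obtain ⟨r, hr, hr'⟩ := hform φ
    rw [← hLw, ← hr']
    exact (hLr r hr).2
  obtain ⟨δ, hδ⟩ : w ∣ D k := by
    rw [← hlamD]
    exact hform' lam.toLinearMap
  have hw0 : w ≠ 0 := fun h => hDk (by rw [hδ, h, zero_mul])
  have hδ0 : δ ≠ 0 := fun h => hDk (by rw [hδ, h, mul_zero])
  have hkill : ∀ (φ : T →ₗ[O] O), ∀ x ∈ Submodule.torsion O T, φ x = 0 := by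
    intro φ x hx
    obtain ⟨a, ha⟩ := (Submodule.mem_torsion_iff _).1 hx
    have h1 : (a : O) * φ x = 0 := by
      rw [← smul_eq_mul, ← map_smul]
      exact (congrArg φ ha).trans (map_zero φ)
    exact (mul_eq_zero.1 h1).resolve_left (nonZeroDivisors.coe_ne_zero a)
  have htm : ∀ (y : T) (x : T), x ∈ Submodule.torsion O T → y * x ∈ Submodule.torsion O T := by
    intro y x hx
    obtain ⟨a, ha⟩ := (Submodule.mem_torsion_iff _).1 hx
    refine (Submodule.mem_torsion_iff _).2 ⟨a, ?_⟩
    rw [← mul_smul_comm, ha, mul_zero]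
  -- All linear forms at `Δₖ(t)` are divisible by `w`, so `Δₖ(t) = w s₀` modulo torsion; applying
  -- `λ` yields `λ(s₀) = Dₖ / w = δ`.
  obtain ⟨s₀, hs₀⟩ := exists_smul_add_torsion w (aeval t (signedMinors N k)) hform'
  have hlams₀ : lam s₀ = δ := by
    have h1 := hkill lam.toLinearMap _ hs₀
    rw [AlgHom.toLinearMap_apply, map_sub, map_smul, hlamD, hδ, smul_eq_mul, ← mul_sub] at h1
    exact (sub_eq_zero.1 ((mul_eq_zero.1 h1).resolve_left hw0)).symm
  have hs₀t : ∀ p ∈ RingHom.ker lam, p * s₀ ∈ Submodule.torsion O T := by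
    intro p hp
    have h1 := htm p _ hs₀
    rw [mul_sub, hP.mul_signedMinors_mem_torsion hN k p hp, zero_sub, neg_mem_iff,
      mul_smul_comm] at h1
    obtain ⟨a, ha⟩ := (Submodule.mem_torsion_iff _).1 h1
    refine (Submodule.mem_torsion_iff _).2 ⟨a * ⟨w, mem_nonZeroDivisors_of_ne_zero hw0⟩, ?_⟩
    rw [mul_smul]
    exact ha
  refine ⟨w, δ, hδ0, ?_, ⟨∑ j, C (c j) * f j, ?_, ?_, ?_, fun a => ?_⟩, fun a => ⟨?_, ?_⟩⟩
  · rw [hP.fittingIdeal_cotangent hN k c hck hc, ← hD, hδ, mul_comm]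
  · exact (hP.mem_ker_iff _).2 ⟨_, rfl⟩
  · rw [sum_mul_mem_sq_iff hN]
    simpa using hc
  · intro x hx hx2
    obtain ⟨u, rfl⟩ := (hP.mem_ker_iff _).1 hx
    have h1 := hcker _ ((sum_mul_mem_sq_iff hN u).1 hx2)
    refine ⟨constantCoeff (u k), (hP.mem_mul_ker_iff _).2
      ⟨fun j => u j - C (constantCoeff (u k) * c j), fun j => ?_, ?_⟩⟩
    · rw [map_sub, constantCoeff_C, h1 j, sub_self]
    · rw [Finset.mul_sum, ← Finset.sum_sub_distrib]
      refine Finset.sum_congr rfl fun j _ => ?_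
      simp only [C_mul]
      ring
  · rw [hP.mem_mul_ker_iff, ← hLw]
    constructor
    · rintro ⟨u, hu, hu'⟩
      -- Two expressions of `a x₀` through the `fⱼ` differ by a syzygy; here its constant term is `a
      -- c`.
      have h1 : ∑ j, (C (a * c j) - u j) * f j = 0 := by
        simp only [sub_mul, Finset.sum_sub_distrib, hu', Finset.mul_sum, C_mul, mul_assoc, sub_self]
      exact ⟨_, h1, fun j => by rw [map_sub, constantCoeff_C, hu, sub_zero]⟩
    · rintro ⟨r, hr, hr'⟩
      refine ⟨fun j => C (a * c j) - r j, fun j => ?_, ?_⟩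
      · rw [map_sub, constantCoeff_C, hr', sub_self]
      · simp only [sub_mul, Finset.sum_sub_distrib, hr, Finset.mul_sum, C_mul, mul_assoc, sub_zero]
  -- The form `φ` of a syzygy with constant term `w c` satisfies `φ(s₀) = 1`. Evaluating `φ(s s₀)`
  -- through each factor in turn gives `λ(s) = δ φ(s)`.
  · rintro ⟨s, rfl, hs⟩
    obtain ⟨r, hr, hr'⟩ := (hLw w).2 dvd_rfl
    obtain ⟨φ, hφ⟩ := exists_form_of_relation lam t hP.apply_eq_zero hP.surjective f hP.ker_eq N
      hN r hr
    have h1 : φ s₀ = 1 := by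
      have h2 := hkill φ _ hs₀
      rw [map_sub, hφ, hr', hck, mul_one, map_smul, smul_eq_mul, sub_eq_zero] at h2
      exact mul_left_cancel₀ hw0 (by rw [← h2, mul_one])
    have h2 : (s - algebraMap O T (lam s)) * s₀ ∈ Submodule.torsion O T :=
      hs₀t _ (by rw [RingHom.mem_ker, map_sub, AlgHom.commutes]; exact sub_self _)
    have h3 : (s₀ - algebraMap O T (lam s₀)) * s ∈ Submodule.torsion O T :=
      hs _ (by rw [RingHom.mem_ker, map_sub, AlgHom.commutes]; exact sub_self _)
    have h4 := hkill φ _ h2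
    have h5 := hkill φ _ h3
    rw [sub_mul, ← Algebra.smul_def, map_sub, map_smul, h1, sub_eq_zero] at h4
    rw [sub_mul, ← Algebra.smul_def, map_sub, map_smul, mul_comm, h4, hlams₀, sub_eq_zero] at h5
    refine ⟨φ s, ?_⟩
    simpa using h5
  · rintro ⟨u, rfl⟩
    refine ⟨u • s₀, ?_, fun p hp => ?_⟩
    · rw [map_smul, hlams₀, smul_eq_mul, mul_comm]
    · rw [mul_smul_comm]
      exact Submodule.smul_mem _ _ (hs₀t p hp)

end Core

/-! ### The first homology of the cotangent complex -/

section Lift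

variable {O : Type*} {T : Type*} {P : Type*} [CommRing O] [CommRing T] [CommRing P]
  [Algebra O T] [Algebra O P] [Algebra P T] [Algebra T O] [IsScalarTower O P T]
  [IsScalarTower O T O] {E : Type*} [AddCommGroup E] [Module O E]

/-- Derivations of `P` into an `O`-module, on which `P` acts through `P → T → O`, factor through
`O ⊗_T T ⊗_P Ω_{P/O}`. -/
theorem exists_lift_of_leibniz (D : P →ₗ[O] E)
    (hD : ∀ a b, D (a * b) = algebraMap T O (algebraMap P T a) • D b +
      algebraMap T O (algebraMap P T b) • D a) :
    ∃ Φ : O ⊗[T] (T ⊗[P] Ω[P⁄O]) →ₗ[O] E,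
      ∀ a, Φ (1 ⊗ₜ (1 ⊗ₜ KaehlerDifferential.D O P a)) = D a := by
  let _ : Module T E := Module.compHom E (algebraMap T O)
  let _ : Module P E := Module.compHom E ((algebraMap T O).comp (algebraMap P T))
  have _ : IsScalarTower T O E := ⟨fun t x e => by
    rw [Algebra.smul_def, mul_smul]
    rfl⟩
  have _ : IsScalarTower P T E := ⟨fun p t e => by
    rw [Algebra.smul_def]
    change (algebraMap T O (algebraMap P T p * t)) • e = _
    rw [map_mul, mul_smul]
    rfl⟩
  have _ : IsScalarTower O P E := ⟨fun r p e => by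
    change (algebraMap T O (algebraMap P T (r • p))) • e = r • (algebraMap T O (algebraMap P T p)) • e
    rw [Algebra.smul_def, map_mul, map_mul, ← IsScalarTower.algebraMap_apply O P T,
      ← IsScalarTower.algebraMap_apply O T O, mul_smul]
    rfl⟩
  let D' : Derivation O P E := Derivation.mk' D fun a b => hD a b
  refine ⟨LinearMap.liftBaseChange O (LinearMap.liftBaseChange T D'.liftKaehlerDifferential),
    fun a => ?_⟩
  rw [LinearMap.liftBaseChange_tmul, LinearMap.liftBaseChange_tmul, one_smul, one_smul,
    Derivation.liftKaehlerDifferential_comp_D]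
  rfl

end Lift

/-! ### Comparing homomorphisms over `T` -/

section Compare

variable {O T P P' : Type*} [CommRing O] [CommRing T] [CommRing P] [CommRing P'] [Algebra O T]
  [Algebra O P] [Algebra O P'] (lam : T →ₐ[O] O) (π : P →ₐ[O] T) (π' : P' →ₐ[O] T)

theorem map_mem_ker_pow (u : P →ₐ[O] P') (hu : π'.comp u = π) (k : ℕ) (p : P)
    (hp : p ∈ RingHom.ker (lam.comp π) ^ k) : u p ∈ RingHom.ker (lam.comp π') ^ k := by
  have h1 : RingHom.ker (lam.comp π) ≤ (RingHom.ker (lam.comp π')).comap u := by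
    intro x hx
    rw [Ideal.mem_comap, RingHom.mem_ker, ← AlgHom.comp_apply, AlgHom.comp_assoc, hu]
    exact hx
  have h2 := Ideal.mem_map_of_mem u hp
  rw [Ideal.map_pow] at h2
  exact Ideal.pow_right_mono (Ideal.map_le_iff_le_comap.2 h1) k h2

/-- Two homomorphisms of algebras over `T` agree on the square of the kernel of the map to `O`,
up to the product of the kernels of the maps to `O` and to `T`. -/
theorem sub_mem_ker_mul_ker (u v : P →ₐ[O] P') (hu : π'.comp u = π) (hv : π'.comp v = π) (p : P)
    (hp : p ∈ RingHom.ker (lam.comp π) ^ 2) :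
    u p - v p ∈ RingHom.ker (lam.comp π') * RingHom.ker π' := by
  have h1 : ∀ p, u p - v p ∈ RingHom.ker π' := by
    intro p
    rw [RingHom.mem_ker, map_sub, ← AlgHom.comp_apply, ← AlgHom.comp_apply, hu, hv, sub_self]
  have h2 : ∀ w : P →ₐ[O] P', π'.comp w = π → ∀ p ∈ RingHom.ker (lam.comp π),
      w p ∈ RingHom.ker (lam.comp π') := by
    intro w hw p hp
    simpa using map_mem_ker_pow lam π π' w hw 1 p (by rwa [pow_one])
  rw [pow_two] at hp
  induction hp using Submodule.mul_induction_on' with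
  | mem_mul_mem a ha b hb =>
    have h : u (a * b) - v (a * b) = u b * (u a - v a) + v a * (u b - v b) := by
      rw [map_mul, map_mul]
      ring
    rw [h]
    exact add_mem (Ideal.mul_mem_mul (h2 u hu b hb) (h1 a)) (Ideal.mul_mem_mul (h2 v hv a ha) (h1 b))
  | add x _ y _ hx hy =>
    convert add_mem hx hy using 1
    rw [map_add, map_add]
    ring

end Compare

/-! ### Differentials in the tensored cotangent complex -/

section Terms

variable (O : Type u) (T : Type w) [CommRing O] [CommRing T] [Algebra O T] [Algebra T O]

/-- The element `1 ⊗ da` of `O ⊗_T Lₙ`. -/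
def termMk (n : ℕ) (a : Res O T n) : O ⊗[T] CotangentTerm O T n :=
  (1 : O) ⊗ₜ[T] cotangentMk O T n 1 a

variable {O T}

theorem baseChangeD_termMk (n : ℕ) (a : Res O T (n + 1)) :
    baseChangeD O T O n (termMk O T (n + 1) a) =
      ∑ i : Fin (n + 2), (-1 : ℤ) ^ (i : ℕ) • termMk O T n (face O T n i a) := by
  rw [baseChangeD, termMk, LinearMap.baseChange_tmul, cotangentD, LinearMap.sum_apply,
    TensorProduct.tmul_sum]
  refine Finset.sum_congr rfl fun i _ => ?_
  rw [LinearMap.smul_apply, cotangentFace_mk, termMk]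
  exact map_zsmul (TensorProduct.mk T O (CotangentTerm O T n) 1) _ _

theorem termMk_add (n : ℕ) (a b : Res O T n) :
    termMk O T n (a + b) = termMk O T n a + termMk O T n b := by
  rw [termMk, cotangentMk, map_add, TensorProduct.tmul_add]
  exact TensorProduct.tmul_add _ _ _

theorem termMk_algebraMap (n : ℕ) (r : O) : termMk O T n (algebraMap O _ r) = 0 := by
  rw [termMk, cotangentMk, Derivation.map_algebraMap, TensorProduct.tmul_zero]
  exact TensorProduct.tmul_zero _ _

theorem termMk_mul (n : ℕ) (a b : Res O T n) :
    termMk O T n (a * b) = algebraMap T O (aug O T n a) • termMk O T n b +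
      algebraMap T O (aug O T n b) • termMk O T n a := by
  have h : ∀ a b : Res O T n, (1 : O) ⊗ₜ[T] ((1 : T) ⊗ₜ[Res O T n]
      (a • KaehlerDifferential.D O (Res O T n) b) : CotangentTerm O T n) =
      algebraMap T O (aug O T n a) • termMk O T n b := by
    intro a b
    have e : ((1 : T) ⊗ₜ[Res O T n] (a • KaehlerDifferential.D O (Res O T n) b) :
        T ⊗[Res O T n] Ω[Res O T n⁄O]) =
        aug O T n a • ((1 : T) ⊗ₜ[Res O T n] KaehlerDifferential.D O (Res O T n) b) := by
      rw [TensorProduct.tmul_smul, TensorProduct.smul_tmul', TensorProduct.smul_tmul',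
        Algebra.smul_def, smul_eq_mul]
      rfl
    have e' : (1 : O) ⊗ₜ[T] (aug O T n a • cotangentMk O T n 1 b) =
        algebraMap T O (aug O T n a) • termMk O T n b := by
      rw [TensorProduct.tmul_smul, termMk, algebraMap_smul]
    exact (congrArg (fun x : CotangentTerm O T n => (1 : O) ⊗ₜ[T] x) e).trans e'
  rw [← h a b, ← h b a, termMk, cotangentMk, Derivation.leibniz, TensorProduct.tmul_add]
  exact TensorProduct.tmul_add _ _ _

theorem exists_lift_termMk [IsScalarTower O T O] {E : Type*} [AddCommGroup E] [Module O E] (n : ℕ)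
    (D : Res O T n →ₗ[O] E)
    (hD : ∀ a b, D (a * b) = algebraMap T O (aug O T n a) • D b +
      algebraMap T O (aug O T n b) • D a) :
    ∃ Φ : O ⊗[T] CotangentTerm O T n →ₗ[O] E, ∀ a, Φ (termMk O T n a) = D a :=
  exists_lift_of_leibniz D hD

theorem span_termMk (n : ℕ) : Submodule.span O (Set.range (termMk O T n)) = ⊤ := by
  set W := Submodule.span O (Set.range (termMk O T n)) with hW
  have h : (W.mkQ.restrictScalars T) ∘ₗ TensorProduct.mk T O (CotangentTerm O T n) 1 = 0 := by
    refine cotangentTerm_hom_ext O T fun a => ?_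
    rw [LinearMap.zero_apply]
    exact (Submodule.Quotient.mk_eq_zero W).2 (Submodule.subset_span ⟨a, rfl⟩)
  rw [eq_top_iff]
  intro x _
  induction x using TensorProduct.induction_on with
  | zero => exact zero_mem _
  | add x y hx hy => exact add_mem (hx trivial) (hy trivial)
  | tmul r y =>
    have h1 : (1 : O) ⊗ₜ[T] y ∈ W := (Submodule.Quotient.mk_eq_zero W).1 (LinearMap.congr_fun h y)
    have h2 := W.smul_mem r h1
    rwa [TensorProduct.smul_tmul', smul_eq_mul, mul_one] at h2

end Terms

section Variables

variable (O : Type u) (T : Type w) [CommRing O] [CommRing T] [Algebra O T]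

/-- The variable `[t]` of `P₀`. -/
def var₀ (t : T) : Res O T 0 := (MvPolynomial.X t : MvPolynomial T O)

/-- The variable `[a]` of `Pₙ₊₁`. -/
def var (n : ℕ) (a : Res O T n) : Res O T (n + 1) :=
  (MvPolynomial.X a : MvPolynomial (Res O T n) O)

variable {O T}

@[simp]
theorem aug_var₀ (t : T) : aug O T 0 (var₀ O T t) = t :=
  MvPolynomial.aeval_X _ _

@[simp]
theorem face_zero_var (n : ℕ) (a : Res O T n) : face O T n 0 (var O T n a) = a := by
  cases n <;> exact MvPolynomial.aeval_X _ _

@[simp]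
theorem face_one_var (a : Res O T 0) :
    face O T 0 1 (var O T 0 a) = var₀ O T (aug O T 0 a) :=
  MvPolynomial.rename_X _ _

@[simp]
theorem face_succ_var (n : ℕ) (i : Fin (n + 2)) (a : Res O T (n + 1)) :
    face O T (n + 1) i.succ (var O T (n + 1) a) = var O T n (face O T n i a) :=
  MvPolynomial.rename_X _ _

@[simp]
theorem aug_var (a : Res O T 0) : aug O T 1 (var O T 0 a) = aug O T 0 a := by
  rw [← aug_comp_face O T 0 0, AlgHom.comp_apply, face_zero_var]

theorem aug_face (n : ℕ) (i : Fin (n + 2)) (a : Res O T (n + 1)) :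
    aug O T n (face O T n i a) = aug O T (n + 1) a := by
  rw [← aug_comp_face O T n i, AlgHom.comp_apply]

theorem face_face (n : ℕ) (i j : Fin (n + 2)) (hij : i ≤ j) (a : Res O T (n + 1 + 1)) :
    face O T n i (face O T (n + 1) j.succ a) = face O T n j (face O T (n + 1) i.castSucc a) :=
  DFunLike.congr_fun (face_comp_face O T n i j hij) a

end Variables

/-! ### Degree one modulo boundaries -/

section Boundary

variable (O : Type u) (T : Type w) [CommRing O] [CommRing T] [Algebra O T] [Algebra T O]

/-- The quotient of `O ⊗_T L₁` by the boundaries. -/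
abbrev TermQuotient : Type (max u w) :=
  (O ⊗[T] CotangentTerm O T 1) ⧸ LinearMap.range (baseChangeD O T O 1)

/-- The class of `d[p]` modulo boundaries. -/
def varClass (p : Res O T 0) : TermQuotient O T :=
  (LinearMap.range (baseChangeD O T O 1)).mkQ (termMk O T 1 (var O T 0 p))

variable {O T}

/-- This is the boundary of `d[q]` in degree two: the faces of the variable `[q]` are `q`, `[d₀ q]`
and `[d₁ q]`. -/
theorem mkQ_termMk (q : Res O T 1) :
    (LinearMap.range (baseChangeD O T O 1)).mkQ (termMk O T 1 q) =
      varClass O T (face O T 0 0 q) - varClass O T (face O T 0 1 q) := by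
  have h := baseChangeD_termMk 1 (var O T 1 q)
  rw [Fin.sum_univ_three] at h
  have e1 : face O T 1 1 (var O T 1 q) = var O T 0 (face O T 0 0 q) := face_succ_var 0 0 q
  have e2 : face O T 1 2 (var O T 1 q) = var O T 0 (face O T 0 1 q) := face_succ_var 0 1 q
  rw [face_zero_var, e1, e2] at h
  have h2 : (LinearMap.range (baseChangeD O T O 1)).mkQ
      (baseChangeD O T O 1 (termMk O T 2 (var O T 1 q))) = 0 :=
    (Submodule.Quotient.mk_eq_zero _).2 ⟨_, rfl⟩
  rw [h] at h2
  simp only [Fin.val_zero, pow_zero, one_smul, Fin.val_one, pow_one, Fin.val_two, map_add,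
    neg_smul, map_neg, even_two, Even.neg_pow, one_pow] at h2
  rw [varClass, varClass, ← sub_eq_zero, ← h2]
  abel

theorem varClass_var₀ (t : T) : varClass O T (var₀ O T t) = 0 := by
  have h := mkQ_termMk (var O T 0 (var₀ O T t))
  rw [face_zero_var, face_one_var, aug_var₀, sub_self] at h
  exact h

/-- Apply `mkQ_termMk` to `[p] + [p']`. The correction term depends only on the images in `T`, so it
cancels for differences of classes of elements with the same image; the product and difference
formulas work alike. -/
theorem varClass_add (p p' : Res O T 0) : varClass O T p + varClass O T p' =
    varClass O T (p + p') - varClass O T (var₀ O T (aug O T 0 p) + var₀ O T (aug O T 0 p')) := by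
  have h := mkQ_termMk (var O T 0 p + var O T 0 p')
  rw [termMk_add, map_add, map_add, map_add, face_zero_var, face_zero_var, face_one_var,
    face_one_var] at h
  exact h

theorem varClass_mul (p p' : Res O T 0) :
    algebraMap T O (aug O T 0 p) • varClass O T p' +
      algebraMap T O (aug O T 0 p') • varClass O T p =
    varClass O T (p * p') - varClass O T (var₀ O T (aug O T 0 p) * var₀ O T (aug O T 0 p')) := by
  have h := mkQ_termMk (var O T 0 p * var O T 0 p')
  rw [termMk_mul, map_add, map_mul, map_mul, face_zero_var, face_zero_var, face_one_var,
    face_one_var, map_smul, map_smul, aug_var, aug_var] at h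
  exact h

theorem varClass_sub (p p' : Res O T 0) : varClass O T p - varClass O T p' =
    varClass O T (p - p') - varClass O T (var₀ O T (aug O T 0 p) - var₀ O T (aug O T 0 p')) := by
  have h1 := mkQ_termMk (var O T 0 p - var O T 0 p')
  have h2 : termMk O T 1 (var O T 0 p - var O T 0 p') =
      termMk O T 1 (var O T 0 p) - termMk O T 1 (var O T 0 p') := by
    rw [eq_sub_iff_add_eq, ← termMk_add, sub_add_cancel]
  rw [h2, map_sub, map_sub, map_sub, face_zero_var, face_zero_var, face_one_var, face_one_var] at h1
  exact h1

/-- The class of `d[i] - d[0]`; it is linear in `i` for `i` in the kernel of the augmentation. -/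
def kerClass (i : Res O T 0) : TermQuotient O T := varClass O T i - varClass O T 0

theorem kerClass_add (i j : Res O T 0) (hi : aug O T 0 i = 0) (hj : aug O T 0 j = 0) :
    kerClass (i + j) = kerClass i + kerClass j := by
  have h1 := varClass_add i j
  have h2 := varClass_add (0 : Res O T 0) 0
  rw [hi, hj] at h1
  rw [map_zero, add_zero] at h2
  rw [kerClass, kerClass, kerClass, ← add_sub_add_comm, h1, h2]
  abel

theorem kerClass_mul (p i : Res O T 0) (hi : aug O T 0 i = 0) :
    kerClass (p * i) = algebraMap T O (aug O T 0 p) • kerClass i := by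
  have h1 := varClass_mul p i
  have h2 := varClass_mul p 0
  rw [hi, map_zero, zero_smul, add_zero] at h1
  rw [map_zero, map_zero, zero_smul, add_zero, mul_zero] at h2
  rw [kerClass, kerClass, smul_sub, h1, h2]
  abel

theorem varClass_eq_kerClass (p : Res O T 0) :
    varClass O T p = kerClass (p - var₀ O T (aug O T 0 p)) := by
  have h := varClass_sub p (var₀ O T (aug O T 0 p))
  rw [aug_var₀, sub_self, varClass_var₀, sub_zero] at h
  exact h

/-- The class is semilinear through `P₀ → T → O`, so the factor in the kernel of `P₀ → O` acts by
zero. -/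
theorem kerClass_eq_zero (i : Res O T 0)
    (hi : i ∈ RingHom.ker ((algebraMap T O).comp (aug O T 0).toRingHom) *
      RingHom.ker (aug O T 0)) : kerClass i = 0 := by
  have h : ∀ i ∈ RingHom.ker ((algebraMap T O).comp (aug O T 0).toRingHom) *
      RingHom.ker (aug O T 0), aug O T 0 i = 0 ∧ kerClass i = 0 := by
    intro i hi
    induction hi using Submodule.mul_induction_on' with
    | mem_mul_mem a ha b hb =>
      refine ⟨by rw [map_mul, (RingHom.mem_ker).1 hb, mul_zero], ?_⟩
      have ha' : algebraMap T O (aug O T 0 a) = 0 := ha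
      rw [kerClass_mul a b hb, ha', zero_smul]
    | add x _ y _ hx hy =>
      refine ⟨by rw [map_add, hx.1, hy.1, add_zero], ?_⟩
      rw [kerClass_add x y hx.1 hy.1, hx.2, hy.2, add_zero]
  exact (h i hi).2

variable [IsScalarTower O T O]

theorem kerClass_smul (r : O) (i : Res O T 0) (hi : aug O T 0 i = 0) :
    kerClass (r • i) = r • kerClass i := by
  rw [Algebra.smul_def, kerClass_mul _ i hi, AlgHom.commutes,
    ← IsScalarTower.algebraMap_apply O T O]
  rfl

/-- The differentials `d[p]` span modulo boundaries, and `d[p]` has the class of `p - [p̄]`, where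
`p̄` is the image of `p` in `T`. -/
theorem exists_kerClass (x : TermQuotient O T) :
    ∃ i, aug O T 0 i = 0 ∧ x = kerClass i := by
  let W : Submodule O (TermQuotient O T) :=
    { carrier := {x | ∃ i, aug O T 0 i = 0 ∧ x = kerClass i}
      zero_mem' := ⟨0, map_zero _, (sub_self _).symm⟩
      add_mem' := by
        rintro _ _ ⟨i, hi, rfl⟩ ⟨j, hj, rfl⟩
        exact ⟨i + j, by rw [map_add, hi, hj, add_zero], (kerClass_add i j hi hj).symm⟩
      smul_mem' := by
        rintro r _ ⟨i, hi, rfl⟩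
        exact ⟨r • i, by rw [map_smul, hi, smul_zero], (kerClass_smul r i hi).symm⟩ }
  have hvar : ∀ p, varClass O T p ∈ W := fun p =>
    ⟨_, by rw [map_sub, aug_var₀, sub_self], varClass_eq_kerClass p⟩
  obtain ⟨y, rfl⟩ := (LinearMap.range (baseChangeD O T O 1)).mkQ_surjective x
  have hy : y ∈ Submodule.span O (Set.range (termMk O T 1)) := by
    rw [span_termMk]
    trivial
  have h : Submodule.span O (Set.range (termMk O T 1)) ≤
      W.comap (LinearMap.range (baseChangeD O T O 1)).mkQ := by
    rw [Submodule.span_le]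
    rintro _ ⟨q, rfl⟩
    change _ ∈ W
    rw [mkQ_termMk]
    exact W.sub_mem (hvar _) (hvar _)
  exact h hy

end Boundary

/-! ### Cycles in degree one and the Fitting ideal of `H₁` -/

section H1

variable {O : Type u} {T : Type w} [CommRing O] [CommRing T] [Algebra O T] [Algebra T O]


/-- The cycle `d[i] - d[0]` for `i` in the kernel of the augmentation. -/
def kerTerm (i : Res O T 0) : O ⊗[T] CotangentTerm O T 1 :=
  termMk O T 1 (var O T 0 i) - termMk O T 1 (var O T 0 0)

theorem baseChangeD_kerTerm (i : Res O T 0) (hi : aug O T 0 i = 0) :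
    baseChangeD O T O 0 (kerTerm i) = termMk O T 0 i := by
  have h : ∀ p, baseChangeD O T O 0 (termMk O T 1 (var O T 0 p)) =
      termMk O T 0 p - termMk O T 0 (var₀ O T (aug O T 0 p)) := by
    intro p
    rw [baseChangeD_termMk, Fin.sum_univ_two]
    simp [sub_eq_add_neg]
  have h0 : termMk O T 0 (0 : Res O T 0) = 0 := by
    have := termMk_algebraMap (O := O) (T := T) 0 0
    rwa [map_zero] at this
  rw [kerTerm, map_sub, h, h, hi, map_zero, h0]
  abel

variable [IsScalarTower O T O]

/-- The map `P₀ → T → O`. -/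
def augO : Res O T 0 →ₐ[O] O := (IsScalarTower.toAlgHom O T O).comp (aug O T 0)

/-- Modulo the square of the kernel of `P₀ → O`, the map sending an element to its difference from
its constant value is a derivation, hence factors through `d`. -/
theorem mem_sq_of_termMk_eq_zero (i : Res O T 0) (hi : augO i = 0) (h : termMk O T 0 i = 0) :
    i ∈ RingHom.ker (augO (O := O) (T := T)) ^ 2 := by
  let I : Ideal (Res O T 0) := RingHom.ker (augO (O := O) (T := T)) ^ 2
  let D : Res O T 0 →ₗ[O] Res O T 0 ⧸ I :=
    (Ideal.Quotient.mkₐ O I).toLinearMap ∘ₗ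
      (LinearMap.id - (Algebra.linearMap O _) ∘ₗ (augO (O := O) (T := T)).toLinearMap)
  have hD : ∀ a, D a = Ideal.Quotient.mk I (a - algebraMap O _ (augO a)) := fun a => rfl
  obtain ⟨Φ, hΦ⟩ := exists_lift_termMk 0 D (fun a b => by
    change D (a * b) = augO a • D b + augO b • D a
    rw [hD, hD, hD, Algebra.smul_def, Algebra.smul_def,
      IsScalarTower.algebraMap_apply O (Res O T 0) (Res O T 0 ⧸ I),
      IsScalarTower.algebraMap_apply O (Res O T 0) (Res O T 0 ⧸ I),
      Ideal.Quotient.algebraMap_eq, ← map_mul, ← map_mul, ← map_add, Ideal.Quotient.eq]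
    have h1 : ∀ a : Res O T 0, a - algebraMap O _ (augO a) ∈
        RingHom.ker (augO (O := O) (T := T)) := by
      intro a
      rw [RingHom.mem_ker, map_sub, AlgHom.commutes]
      exact sub_self _
    have h2 : a * b - algebraMap O (Res O T 0) (augO (a * b)) -
        (algebraMap O _ (augO a) * (b - algebraMap O _ (augO b)) +
          algebraMap O _ (augO b) * (a - algebraMap O _ (augO a))) =
        (a - algebraMap O _ (augO a)) * (b - algebraMap O _ (augO b)) := by
      rw [map_mul, map_mul]
      ring
    rw [h2]
    change _ ∈ RingHom.ker (augO (O := O) (T := T)) ^ 2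
    rw [pow_two]
    exact Ideal.mul_mem_mul (h1 a) (h1 b))
  have h1 := hΦ i
  rw [h, map_zero, hD, hi, map_zero, sub_zero] at h1
  exact Ideal.Quotient.eq_zero_iff_mem.1 h1.symm

theorem termMk_eq_zero_of_mem_sq (i : Res O T 0)
    (hi : i ∈ RingHom.ker (augO (O := O) (T := T)) ^ 2) : termMk O T 0 i = 0 := by
  rw [pow_two] at hi
  induction hi using Submodule.mul_induction_on' with
  | mem_mul_mem a ha b hb =>
    have ha' : algebraMap T O (aug O T 0 a) = 0 := ha
    have hb' : algebraMap T O (aug O T 0 b) = 0 := hb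
    rw [termMk_mul, ha', hb', zero_smul, zero_smul, add_zero]
  | add x _ y _ hx hy => rw [termMk_add, hx, hy, add_zero]

variable {A : Type*} [CommRing A] [Algebra O A] (π : A →ₐ[O] T)

/-- For a homomorphism `φ : P₀ → A` over `T`, the class of `φ(i)` depends only on the class of
`d[i] - d[0]` modulo boundaries. -/
theorem map_mem_of_kerClass_eq_zero (φ : Res O T 0 →ₐ[O] A) (hφ : π.comp φ = aug O T 0)
    (i : Res O T 0) (hi : aug O T 0 i = 0) (h : kerClass i = 0) :
    φ i ∈ RingHom.ker ((IsScalarTower.toAlgHom O T O).comp π) * RingHom.ker π := by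
  set I : Ideal A := RingHom.ker ((IsScalarTower.toAlgHom O T O).comp π) * RingHom.ker π with hI
  have hφ' : ∀ p, π (φ p) = aug O T 0 p := fun p => DFunLike.congr_fun hφ p
  -- The difference of the two faces is a derivation modulo `I`: it takes values in `ker π`, on
  -- which `A` acts through `O` modulo `I`.
  let D : Res O T 1 →ₗ[O] A ⧸ I := (Ideal.Quotient.mkₐ O I).toLinearMap ∘ₗ
    ((φ.comp (face O T 0 0)).toLinearMap - (φ.comp (face O T 0 1)).toLinearMap)
  have hD : ∀ q, D q = Ideal.Quotient.mk I (φ (face O T 0 0 q) - φ (face O T 0 1 q)) :=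
    fun q => rfl
  obtain ⟨Φ, hΦ⟩ := exists_lift_termMk 1 D (fun a b => by
    have h1 : ∀ a, φ (face O T 0 0 a) - φ (face O T 0 1 a) ∈ RingHom.ker π := by
      intro a
      rw [RingHom.mem_ker, map_sub, hφ', hφ', aug_face, aug_face, sub_self]
    have h2 : ∀ j a, φ (face O T 0 j a) - algebraMap O A (algebraMap T O (aug O T 1 a)) ∈
        RingHom.ker ((IsScalarTower.toAlgHom O T O).comp π) := by
      intro j a
      rw [RingHom.mem_ker, map_sub, AlgHom.commutes, AlgHom.comp_apply, hφ', aug_face]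
      exact sub_self _
    rw [hD, hD, hD, Algebra.smul_def, Algebra.smul_def,
      IsScalarTower.algebraMap_apply O A (A ⧸ I), IsScalarTower.algebraMap_apply O A (A ⧸ I),
      Ideal.Quotient.algebraMap_eq, ← map_mul, ← map_mul, ← map_add, Ideal.Quotient.eq]
    have h3 : ∀ x y z t r s : A, x * y - z * t - (r * (y - t) + s * (x - z)) =
        (x - r) * (y - t) + (t - s) * (x - z) := by
      intros
      ring
    rw [map_mul, map_mul, map_mul, map_mul, h3]
    exact add_mem (Ideal.mul_mem_mul (h2 0 a) (h1 b)) (Ideal.mul_mem_mul (h2 1 b) (h1 a)))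
  -- On boundaries of generators the six terms cancel in pairs by the simplicial identities.
  have hzero : ∀ x ∈ LinearMap.range (baseChangeD O T O 1), Φ x = 0 := by
    rintro _ ⟨y, rfl⟩
    have hy : y ∈ Submodule.span O (Set.range (termMk O T 2)) := by
      rw [span_termMk]
      trivial
    have h1 : Submodule.span O (Set.range (termMk O T 2)) ≤
        LinearMap.ker (Φ ∘ₗ baseChangeD O T O 1) := by
      rw [Submodule.span_le]
      rintro _ ⟨q, rfl⟩
      change Φ (baseChangeD O T O 1 (termMk O T (1 + 1) q)) = 0
      rw [baseChangeD_termMk, Fin.sum_univ_three, map_add, map_add, map_zsmul, map_zsmul,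
        map_zsmul, hΦ, hΦ, hΦ, hD, hD, hD]
      have e1 : face O T 0 0 (face O T 1 1 q) = face O T 0 0 (face O T 1 0 q) :=
        face_face 0 0 0 le_rfl q
      have e2 : face O T 0 0 (face O T 1 2 q) = face O T 0 1 (face O T 1 0 q) :=
        face_face 0 0 1 (by decide) q
      have e3 : face O T 0 1 (face O T 1 2 q) = face O T 0 1 (face O T 1 1 q) :=
        face_face 0 1 1 le_rfl q
      rw [e1, e2, e3]
      simp only [Fin.val_zero, pow_zero, one_smul, Fin.val_one, pow_one, Fin.val_two,
        neg_smul, even_two, Even.neg_pow, one_pow, map_sub]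
      abel
    exact h1 hy
  have h1 : kerTerm i ∈ LinearMap.range (baseChangeD O T O 1) := by
    rw [kerClass, varClass, varClass, ← map_sub] at h
    exact (Submodule.Quotient.mk_eq_zero _).1 h
  have h2 := hzero _ h1
  rw [kerTerm, map_sub, hΦ, hΦ, hD, hD, face_zero_var, face_one_var, face_zero_var, face_one_var,
    ← map_sub, hi, map_zero, map_zero, zero_sub, sub_neg_eq_add, sub_add_cancel] at h2
  exact Ideal.Quotient.eq_zero_iff_mem.1 h2

/-- Computation of the Fitting ideal of `H₁(L_{T/O} ⊗_T O)` by means of an algebra `A` over `T` which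
is a retract, over `T` and up to homotopy, of the polynomial algebra on `T`. -/
theorem fittingIdeal_cotangentH1 (φ : Res O T 0 →ₐ[O] A) (hφ : π.comp φ = aug O T 0)
    (ψ : A →ₐ[O] Res O T 0) (hψ : (aug O T 0).comp ψ = π) (w : O) (x₀ : A) (hx₀ : π x₀ = 0)
    (hx₀' : x₀ ∈ RingHom.ker ((IsScalarTower.toAlgHom O T O).comp π) ^ 2)
    (hgen : ∀ x, π x = 0 → x ∈ RingHom.ker ((IsScalarTower.toAlgHom O T O).comp π) ^ 2 →
      ∃ a : O, x - a • x₀ ∈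
        RingHom.ker ((IsScalarTower.toAlgHom O T O).comp π) * RingHom.ker π)
    (hw : ∀ a : O, a • x₀ ∈
      RingHom.ker ((IsScalarTower.toAlgHom O T O).comp π) * RingHom.ker π ↔ w ∣ a) :
    fittingIdeal O (CotangentH1 O T O) = Ideal.span {w} := by
  set lam := IsScalarTower.toAlgHom O T O with hlam
  have hφ' : ∀ p, π (φ p) = aug O T 0 p := fun p => DFunLike.congr_fun hφ p
  have hψ' : ∀ p, aug O T 0 (ψ p) = π p := fun p => DFunLike.congr_fun hψ p
  have hmul : ∀ p ∈ RingHom.ker (lam.comp π) * RingHom.ker π,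
      ψ p ∈ RingHom.ker (lam.comp (aug O T 0)) * RingHom.ker (aug O T 0) := by
    intro p hp
    have h2 := Ideal.mem_map_of_mem ψ hp
    rw [Ideal.map_mul] at h2
    refine Ideal.mul_mono (Ideal.map_le_iff_le_comap.2 fun x hx => ?_)
      (Ideal.map_le_iff_le_comap.2 fun x hx => ?_) h2
    · rw [Ideal.mem_comap, RingHom.mem_ker, ← AlgHom.comp_apply, AlgHom.comp_assoc, hψ]
      exact hx
    · rw [Ideal.mem_comap, RingHom.mem_ker, hψ']
      exact hx
  -- For the converse direction, `ψ φ` and the identity agree on the square of the kernel of `P₀ →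
  -- O`, up to elements whose class vanishes.
  have hclass : ∀ i : Res O T 0, aug O T 0 i = 0 → i ∈ RingHom.ker (lam.comp (aug O T 0)) ^ 2 →
      (kerClass i = 0 ↔ φ i ∈ RingHom.ker (lam.comp π) * RingHom.ker π) := by
    intro i hi hi2
    refine ⟨map_mem_of_kerClass_eq_zero π φ hφ i hi, fun h => kerClass_eq_zero i ?_⟩
    have h1 := sub_mem_ker_mul_ker lam (aug O T 0) (aug O T 0) (AlgHom.id O _) (ψ.comp φ)
      (AlgHom.comp_id _) (by rw [← AlgHom.comp_assoc, hψ, hφ]) i hi2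
    have h2 := add_mem h1 (hmul _ h)
    rwa [AlgHom.comp_apply, sub_add_cancel] at h2
  have hmk : ∀ i : Res O T 0, (LinearMap.range (baseChangeD O T O 1)).mkQ (kerTerm i) =
      kerClass i := fun i => map_sub _ _ _
  have hcyc : ∀ i : Res O T 0, aug O T 0 i = 0 → i ∈ RingHom.ker (lam.comp (aug O T 0)) ^ 2 →
      kerTerm i ∈ LinearMap.ker (baseChangeD O T O 0) := by
    intro i hi hi2
    rw [LinearMap.mem_ker, baseChangeD_kerTerm i hi]
    exact termMk_eq_zero_of_mem_sq i hi2
  have hi₀ : aug O T 0 (ψ x₀) = 0 := by rw [hψ', hx₀]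
  have hi₀2 : ψ x₀ ∈ RingHom.ker (lam.comp (aug O T 0)) ^ 2 := map_mem_ker_pow lam π _ ψ hψ 2 x₀ hx₀'
  have hφψ : ∀ a : O, a • φ (ψ x₀) - a • x₀ ∈ RingHom.ker (lam.comp π) * RingHom.ker π := by
    intro a
    have h1 := sub_mem_ker_mul_ker lam π π (φ.comp ψ) (AlgHom.id O _)
      (by rw [← AlgHom.comp_assoc, hφ, hψ]) (AlgHom.comp_id _) x₀ hx₀'
    rw [← smul_sub, Algebra.smul_def]
    exact Ideal.mul_mem_left _ _ h1
  have hquot : ∀ y : LinearMap.ker (baseChangeD O T O 0),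
      (Submodule.Quotient.mk y : CotangentH1 O T O) = 0 ↔
        (LinearMap.range (baseChangeD O T O 1)).mkQ (y : O ⊗[T] CotangentTerm O T 1) = 0 := by
    intro y
    rw [Submodule.mkQ_apply, Submodule.Quotient.mk_eq_zero]
    exact (Submodule.Quotient.mk_eq_zero (LinearMap.range (baseChangeD O T O 1))).symm
  let z : LinearMap.ker (baseChangeD O T O 0) := ⟨kerTerm (ψ x₀), hcyc _ hi₀ hi₀2⟩
  refine fittingIdeal_of_cyclic (Submodule.Quotient.mk z : CotangentH1 O T O) ?_ w ?_
  · intro x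
    obtain ⟨y, rfl⟩ := Submodule.Quotient.mk_surjective _ x
    obtain ⟨i, hi, hyi⟩ := exists_kerClass
      ((LinearMap.range (baseChangeD O T O 1)).mkQ (y : O ⊗[T] CotangentTerm O T 1))
    -- The cycle `y` differs from `d[i] - d[0]` by a boundary, so the latter is a cycle too; its
    -- differential is `d i`.
    have hi2 : i ∈ RingHom.ker (lam.comp (aug O T 0)) ^ 2 := by
      refine mem_sq_of_termMk_eq_zero i ?_ ?_
      · change algebraMap T O (aug O T 0 i) = 0
        rw [hi, map_zero]
      · rw [← baseChangeD_kerTerm i hi]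
        have h1 : kerTerm i - (y : O ⊗[T] CotangentTerm O T 1) ∈
            LinearMap.range (baseChangeD O T O 1) := by
          rw [← Submodule.Quotient.mk_eq_zero, Submodule.Quotient.mk_sub, sub_eq_zero]
          exact ((hmk i).trans hyi.symm)
        have h2 := range_baseChangeD_le_ker O T O 0 h1
        rw [LinearMap.mem_ker, map_sub, LinearMap.mem_ker.1 y.2, sub_zero] at h2
        exact h2
    obtain ⟨a, ha⟩ := hgen (φ i) (by rw [hφ', hi]) (map_mem_ker_pow lam (aug O T 0) π φ hφ 2 i hi2)
    refine ⟨a, ?_⟩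
    rw [← sub_eq_zero]
    refine (hquot (y - a • z)).2 ?_
    have h1 : kerClass (i - a • ψ x₀) = 0 := by
      refine (hclass _ ?_ ?_).2 ?_
      · rw [map_sub, map_smul, hi, hi₀, smul_zero, sub_zero]
      · refine sub_mem hi2 ?_
        rw [Algebra.smul_def]
        exact Ideal.mul_mem_left _ _ hi₀2
      · have h2 := sub_mem ha (hφψ a)
        rw [map_sub, map_smul]
        convert h2 using 1
        abel
    have h2 : kerClass i = kerClass (i - a • ψ x₀) + kerClass (a • ψ x₀) := by
      rw [← kerClass_add, sub_add_cancel]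
      · rw [map_sub, map_smul, hi, hi₀, smul_zero, sub_zero]
      · rw [map_smul, hi₀, smul_zero]
    rw [h1, zero_add, kerClass_smul _ _ hi₀] at h2
    change (LinearMap.range (baseChangeD O T O 1)).mkQ
      ((y : O ⊗[T] CotangentTerm O T 1) - a • kerTerm (ψ x₀)) = 0
    rw [map_sub, map_smul, hyi, hmk, h2, sub_self]
  · intro r
    rw [← hw]
    have h1 : r • (Submodule.Quotient.mk z : CotangentH1 O T O) = 0 ↔
        kerClass (r • ψ x₀) = 0 := by
      rw [kerClass_smul _ _ hi₀, ← hmk, ← map_smul]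
      exact hquot (r • z)
    rw [h1, hclass]
    · rw [map_smul]
      refine ⟨fun h => ?_, fun h => ?_⟩
      · convert sub_mem h (hφψ r) using 1
        abel
      · convert add_mem h (hφψ r) using 1
        abel
    · rw [map_smul, hi₀, smul_zero]
    · rw [Algebra.smul_def]
      exact Ideal.mul_mem_left _ _ hi₀2

end H1

/-! ### The congruence module -/

section Congruence

variable {O : Type*} (K : Type*) {T : Type*} [CommRing O] [Field K] [Algebra O K] [CommRing T]
  [Algebra O T]

theorem one_tmul_eq_zero_iff [IsFractionRing O K] (x : T) :
    (1 : K) ⊗ₜ[O] x = 0 ↔ x ∈ Submodule.torsion O T := by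
  rw [Submodule.mem_torsion_iff]
  have h := IsLocalizedModule.eq_zero_iff O⁰ (TensorProduct.mk O K T 1) (m := x)
  exact h

theorem exists_smul_eq_one_tmul [IsDomain O] [IsFractionRing O K] (y : K ⊗[O] T) :
    ∃ (a : O) (x : T), a ≠ 0 ∧ a • y = (1 : K) ⊗ₜ[O] x := by
  obtain ⟨⟨x, a⟩, h⟩ := IsLocalizedModule.surj O⁰ (TensorProduct.mk O K T 1) y
  exact ⟨a, x, nonZeroDivisors.coe_ne_zero a, h⟩

theorem lamK_one_tmul (lam : T →ₐ[O] O) (x : T) :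
    lamK K lam ((1 : K) ⊗ₜ[O] x) = algebraMap O K (lam x) := by
  simp [lamK, Algebra.algebraMap_eq_smul_one]

variable [IsSemisimpleRing (K ⊗[O] T)] (lam : T →ₐ[O] O)

theorem idem_mul_idem : idem K lam * idem K lam = idem K lam :=
  (exists_idempotent K lam).choose_spec.1

theorem ker_lamK : RingHom.ker (lamK K lam) = Ideal.span {1 - idem K lam} :=
  (exists_idempotent K lam).choose_spec.2

theorem lamK_idem : lamK K lam (idem K lam) = 1 := by
  have h : 1 - idem K lam ∈ RingHom.ker (lamK K lam) := by
    rw [ker_lamK]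
    exact Ideal.mem_span_singleton_self _
  rw [RingHom.mem_ker, map_sub, map_one, sub_eq_zero] at h
  exact h.symm

theorem idem_mul_of_lamK_eq_zero (y : K ⊗[O] T) (hy : lamK K lam y = 0) :
    idem K lam * y = 0 := by
  have h : y ∈ Ideal.span {1 - idem K lam} := by
    rw [← ker_lamK]
    exact hy
  obtain ⟨c, rfl⟩ := Ideal.mem_span_singleton.1 h
  rw [← mul_assoc, mul_sub, mul_one, idem_mul_idem, sub_self, zero_mul]

/-- The idempotent kills `x - λ(x)`, whose image lies in `ker λ_K`. -/
theorem idem_mul_one_tmul (x : T) : idem K lam * (1 : K) ⊗ₜ[O] x = lam x • idem K lam := by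
  have h : idem K lam * (1 : K) ⊗ₜ[O] (x - algebraMap O T (lam x)) = 0 := by
    refine idem_mul_of_lamK_eq_zero K lam _ ?_
    rw [lamK_one_tmul, map_sub, AlgHom.commutes]
    simp
  rw [TensorProduct.tmul_sub, mul_sub, sub_eq_zero] at h
  rw [h, Algebra.algebraMap_eq_smul_one, TensorProduct.tmul_smul, mul_smul_comm]
  congr 1
  exact mul_one _

theorem lamK_smul_idem (r : O) : lamK K lam (r • idem K lam) = algebraMap O K r := by
  rw [AlgHom.map_smul_of_tower, lamK_idem, Algebra.algebraMap_eq_smul_one]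

variable [IsFractionRing O K]

variable [IsDomain O]

/-- A nonzero multiple of `1 - e_λ` comes from an element of `ker λ`, so `1 - e_λ` kills the image
of `s`. -/
theorem one_tmul_eq_smul_idem (s : T)
    (hs : ∀ p ∈ RingHom.ker lam, p * s ∈ Submodule.torsion O T) :
    (1 : K) ⊗ₜ[O] s = lam s • idem K lam := by
  rw [← idem_mul_one_tmul, ← sub_eq_zero]
  have h1 : (1 : K) ⊗ₜ[O] s - idem K lam * (1 : K) ⊗ₜ[O] s =
      (1 - idem K lam) * (1 : K) ⊗ₜ[O] s := by
    rw [sub_mul, one_mul]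
  obtain ⟨a, x, ha, hx⟩ := exists_smul_eq_one_tmul K (1 - idem K lam)
  have h2 : lam x = 0 := by
    refine IsFractionRing.injective O K ?_
    rw [← lamK_one_tmul, ← hx, AlgHom.map_smul_of_tower, map_sub, lamK_idem, map_one, sub_self,
      smul_zero, map_zero]
  have h3 : a • ((1 - idem K lam) * (1 : K) ⊗ₜ[O] s) = 0 := by
    rw [← smul_mul_assoc, hx, Algebra.TensorProduct.tmul_mul_tmul, one_mul, one_tmul_eq_zero_iff]
    exact hs x h2
  rw [h1]
  rw [← algebraMap_smul K a, smul_eq_zero] at h3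
  refine h3.resolve_left fun h => ha (IsFractionRing.injective O K ?_)
  rw [h, map_zero]

theorem one_tmul_eq_smul_idem_iff (r : O) (s : T) : (1 : K) ⊗ₜ[O] s = r • idem K lam ↔
    lam s = r ∧ ∀ p ∈ RingHom.ker lam, p * s ∈ Submodule.torsion O T := by
  refine ⟨fun h => ?_, ?_⟩
  · refine ⟨IsFractionRing.injective O K ?_, fun p hp => ?_⟩
    · rw [← lamK_one_tmul, h, lamK_smul_idem]
    · rw [← one_tmul_eq_zero_iff K, ← one_mul (1 : K), ← Algebra.TensorProduct.tmul_mul_tmul, h,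
        mul_smul_comm, mul_comm, idem_mul_one_tmul, (RingHom.mem_ker).1 hp, zero_smul, smul_zero]
  · rintro ⟨rfl, hs⟩
    exact one_tmul_eq_smul_idem K lam s hs

/-- `e_λ T̃` is free on `e_λ`, and `r e_λ` lies in `T̃` exactly when `r = λ(s)` for some `s` killed
by `ker λ` up to torsion. So `C₀` is cyclic with annihilator `(δ)`. -/
theorem congruenceIdeal_eq (δ : O)
    (hδ : ∀ a : O, (∃ s, lam s = a ∧ ∀ p ∈ RingHom.ker lam, p * s ∈ Submodule.torsion O T) ↔
      δ ∣ a) : congruenceIdeal K lam = Ideal.span {δ} := by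
  have hupper : ∀ y, y ∈ upperLam K lam ↔ ∃ r : O, y = r • idem K lam := by
    intro y
    constructor
    · rintro ⟨_, ⟨x, rfl⟩, rfl⟩
      exact ⟨lam x, idem_mul_one_tmul K lam x⟩
    · rintro ⟨r, rfl⟩
      refine ⟨_, ⟨algebraMap O T r, rfl⟩, (idem_mul_one_tmul K lam _).trans ?_⟩
      rw [AlgHom.commutes]
      rfl
  let z : upperLam K lam := ⟨idem K lam, (hupper _).2 ⟨1, (one_smul _ _).symm⟩⟩
  refine fittingIdeal_of_cyclic (Submodule.Quotient.mk z : CongruenceModule K lam) ?_ δ ?_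
  · intro x
    obtain ⟨⟨y, hy⟩, rfl⟩ := Submodule.Quotient.mk_surjective _ x
    obtain ⟨r, rfl⟩ := (hupper y).1 hy
    exact ⟨r, rfl⟩
  · intro r
    rw [← hδ, ← Submodule.Quotient.mk_smul, Submodule.Quotient.mk_eq_zero]
    have h1 : r • z ∈ (lowerLam K lam).submoduleOf (upperLam K lam) ↔
        r • idem K lam ∈ lowerLam K lam := Iff.rfl
    rw [h1]
    constructor
    · rintro ⟨⟨s, hs⟩, _⟩
      exact ⟨s, (one_tmul_eq_smul_idem_iff K lam r s).1 hs⟩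
    · rintro ⟨s, hs⟩
      refine ⟨⟨s, (one_tmul_eq_smul_idem_iff K lam r s).2 hs⟩, ⟨r • idem K lam, ?_⟩⟩
      rw [LinearMap.mulLeft_apply, mul_smul_comm, idem_mul_idem]

end Congruence

/-- `ker λ / (ker λ)²` is killed by a nonzero scalar. -/
theorem exists_smul_ker_mem_sq {O : Type*} (K : Type*) {T : Type*} [CommRing O] [IsDomain O]
    [IsNoetherianRing O] [Field K] [Algebra O K] [IsFractionRing O K] [CommRing T] [Algebra O T]
    [Module.Finite O T] [IsSemisimpleRing (K ⊗[O] T)] (lam : T →ₐ[O] O) :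
    ∃ b : O, b ≠ 0 ∧ ∀ p ∈ RingHom.ker lam, b • p ∈ RingHom.ker lam ^ 2 := by
  obtain ⟨a, x, ha, hx⟩ := exists_smul_eq_one_tmul K (idem K lam)
  obtain ⟨hxa, hxp⟩ := (one_tmul_eq_smul_idem_iff K lam a x).1 hx.symm
  obtain ⟨c, hc, hc0⟩ := Submodule.annihilator_top_inter_nonZeroDivisors
    (Submodule.torsion_isTorsion (R := O) (M := T))
  refine ⟨c * a, mul_ne_zero (nonZeroDivisors.ne_zero hc0) ha, fun p hp => ?_⟩
  have h1 : c • (p * x) = 0 :=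
    congrArg Subtype.val (Submodule.mem_annihilator.1 hc ⟨_, hxp p hp⟩ Submodule.mem_top)
  -- Here `x` maps to `a e_λ`, so `p x` is torsion, and `c` kills the torsion. The second factor
  -- lies in `ker λ` because `λ(x) = a`.
  have h2 : (c * a) • p = p * ((c * a) • 1 - c • x) := by
    rw [mul_sub, mul_smul_comm, mul_smul_comm, h1, mul_one, sub_zero]
  rw [h2, pow_two]
  refine Ideal.mul_mem_mul hp ?_
  rw [RingHom.mem_ker, map_sub, map_smul, map_smul, map_one, hxa, smul_eq_mul, smul_eq_mul, mul_one,
    sub_self]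

/-! ### From power series presentations to polynomial presentations -/

section PowerSeries

variable {σ R : Type*} [CommRing R]

theorem mem_span_X_of_constantCoeff_eq_zero [Finite σ] (s : MvPowerSeries σ R)
    (hs : MvPowerSeries.constantCoeff s = 0) :
    s ∈ Ideal.span (Set.range (MvPowerSeries.X : σ → MvPowerSeries σ R)) := by
  classical
  have key : ∀ (F : Finset σ) (s : MvPowerSeries σ R),
      (∀ m, (∀ i ∈ F, m i = 0) → MvPowerSeries.coeff m s = 0) →
      s ∈ Ideal.span (Set.range (MvPowerSeries.X : σ → MvPowerSeries σ R)) := by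
    intro F
    induction F using Finset.induction_on with
    | empty =>
      intro s hs
      rw [show s = 0 from MvPowerSeries.ext fun m => by rw [hs m (by simp), map_zero]]
      exact zero_mem _
    | insert j F hj ih =>
      intro s hs
      -- The part of `s` free of `X j`; the rest is divisible by `X j`.
      let s' : MvPowerSeries σ R := fun m => if m j = 0 then MvPowerSeries.coeff m s else 0
      have hs' : ∀ m, MvPowerSeries.coeff m s' =
          if m j = 0 then MvPowerSeries.coeff m s else 0 := fun m => rfl
      have h1 : s' ∈ Ideal.span (Set.range (MvPowerSeries.X : σ → MvPowerSeries σ R)) := by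
        refine ih s' fun m hm => ?_
        rw [hs']
        split_ifs with h
        · refine hs m fun i hi => ?_
          rcases Finset.mem_insert.1 hi with rfl | hi
          · exact h
          · exact hm i hi
        · rfl
      have h2 : MvPowerSeries.X j ∣ s - s' := by
        rw [MvPowerSeries.X_dvd_iff]
        intro m hm
        rw [map_sub, hs', if_pos hm, sub_self]
      have h3 : s - s' ∈ Ideal.span (Set.range (MvPowerSeries.X : σ → MvPowerSeries σ R)) :=
        Ideal.mem_of_dvd _ h2 (Ideal.subset_span ⟨j, rfl⟩)
      simpa using add_mem h3 h1
  cases nonempty_fintype σ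
  refine key Finset.univ s fun m hm => ?_
  have : m = 0 := Finsupp.ext fun i => hm i (Finset.mem_univ i)
  rw [this]
  exact hs

/-- The ideal generated by an ideal of constants and by the variables. -/
def originIdeal (σ : Type*) {R : Type*} [CommRing R] (m : Ideal R) : Ideal (MvPolynomial σ R) :=
  m.map C ⊔ idealOfVars σ R

variable (m : Ideal R)

/-- Density of polynomials: the constant term approximates a series to first order, and
approximating the coefficients of an error in the `k`-th power gains one order. -/
theorem exists_sub_mem_map_originIdeal_pow [Finite σ] (k : ℕ) (s : MvPowerSeries σ R) :
    ∃ p : MvPolynomial σ R, s - algebraMap _ _ p ∈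
      (originIdeal σ m ^ k).map (algebraMap (MvPolynomial σ R) (MvPowerSeries σ R)) := by
  induction k generalizing s with
  | zero => exact ⟨0, by simp [Ideal.map_top]⟩
  | succ k ih =>
    have h1 : ∀ s : MvPowerSeries σ R, ∃ p : MvPolynomial σ R, s - algebraMap _ _ p ∈
        (originIdeal σ m).map (algebraMap (MvPolynomial σ R) (MvPowerSeries σ R)) := by
      intro s
      refine ⟨C (MvPowerSeries.constantCoeff s), ?_⟩
      have e : algebraMap (MvPolynomial σ R) (MvPowerSeries σ R)
          (C (MvPowerSeries.constantCoeff s)) = MvPowerSeries.C (MvPowerSeries.constantCoeff s) :=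
        MvPolynomial.coe_C _
      have h2 := mem_span_X_of_constantCoeff_eq_zero
        (s - algebraMap (MvPolynomial σ R) (MvPowerSeries σ R) (C (MvPowerSeries.constantCoeff s)))
        (by rw [e, map_sub, MvPowerSeries.constantCoeff_C, sub_self])
      refine (Ideal.span_le.2 ?_ : Ideal.span _ ≤ _) h2
      rintro _ ⟨i, rfl⟩
      have e' : algebraMap (MvPolynomial σ R) (MvPowerSeries σ R) (X i) = MvPowerSeries.X i :=
        MvPolynomial.coe_X i
      rw [← e']
      exact Ideal.mem_map_of_mem _ (Ideal.mem_sup_right (X_mem_idealOfVars i))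
    have h2 : ∀ x ∈ (originIdeal σ m ^ k).map
        (algebraMap (MvPolynomial σ R) (MvPowerSeries σ R)), ∃ p : MvPolynomial σ R,
        x - algebraMap _ _ p ∈ (originIdeal σ m ^ (k + 1)).map
          (algebraMap (MvPolynomial σ R) (MvPowerSeries σ R)) := by
      intro x hx
      induction hx using Submodule.span_induction with
      | mem x hx =>
        obtain ⟨a, ha, rfl⟩ := hx
        exact ⟨a, by rw [sub_self]; exact zero_mem _⟩
      | zero => exact ⟨0, by simp⟩
      | add x y _ _ hx hy =>
        obtain ⟨p, hp⟩ := hx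
        obtain ⟨q, hq⟩ := hy
        refine ⟨p + q, ?_⟩
        convert add_mem hp hq using 1
        rw [map_add]
        ring
      | smul c x hx0 hx =>
        obtain ⟨p, hp⟩ := hx
        obtain ⟨q, hq⟩ := h1 c
        refine ⟨q * p, ?_⟩
        have e : c • x - algebraMap (MvPolynomial σ R) (MvPowerSeries σ R) (q * p) =
            (c - algebraMap _ _ q) * x + algebraMap _ _ q * (x - algebraMap _ _ p) := by
          rw [map_mul, smul_eq_mul]
          ring
        rw [e]
        refine add_mem ?_ (Ideal.mul_mem_left _ _ hp)
        rw [pow_succ', Ideal.map_mul]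
        exact Ideal.mul_mem_mul hq hx0
    obtain ⟨p, hp⟩ := ih s
    obtain ⟨q, hq⟩ := h2 _ hp
    refine ⟨p + q, ?_⟩
    rwa [map_add, ← sub_sub]

/-- Truncation in total degree maps power series to polynomials modulo the `k`-th power and is the
quotient map on polynomials. -/
theorem mem_originIdeal_pow_of_algebraMap_mem [Finite σ] (k : ℕ) (p : MvPolynomial σ R)
    (hp : algebraMap (MvPolynomial σ R) (MvPowerSeries σ R) p ∈
      (originIdeal σ m ^ k).map (algebraMap (MvPolynomial σ R) (MvPowerSeries σ R))) :
    p ∈ originIdeal σ m ^ k := by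
  have hle : idealOfVars σ R ^ k ≤ originIdeal σ m ^ k := Ideal.pow_right_mono le_sup_right k
  let Φ : MvPowerSeries σ R →+* MvPolynomial σ R ⧸ originIdeal σ m ^ k :=
    (Ideal.Quotient.factor hle).comp (MvPowerSeries.truncTotalAlgHom σ R k).toRingHom
  have hΦ : ∀ q : MvPolynomial σ R, Φ (algebraMap _ _ q) = Ideal.Quotient.mk _ q := by
    intro q
    have h : MvPowerSeries.truncTotalAlgHom σ R k (algebraMap _ _ q) =
        Ideal.Quotient.mk (idealOfVars σ R ^ k) q :=
      (MvPowerSeries.truncTotalAlgHom σ R k).commutes q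
    change Ideal.Quotient.factor hle (MvPowerSeries.truncTotalAlgHom σ R k (algebraMap _ _ q)) = _
    rw [h, Ideal.Quotient.factor_mk]
  have h1 : (originIdeal σ m ^ k).map (algebraMap (MvPolynomial σ R) (MvPowerSeries σ R)) ≤
      RingHom.ker Φ := by
    rw [Ideal.map_le_iff_le_comap]
    intro q hq
    rw [Ideal.mem_comap, RingHom.mem_ker, hΦ]
    exact Ideal.Quotient.eq_zero_iff_mem.2 hq
  have h2 := h1 hp
  rw [RingHom.mem_ker, hΦ] at h2
  exact Ideal.Quotient.eq_zero_iff_mem.1 h2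

end PowerSeries

/-! ### Nakayama and Artin–Rees -/

section Nakayama

variable {R : Type*} [CommRing R]

/-- Nakayama's lemma, in its form without a locality assumption, for the image of `I` in `R ⧸ F`. -/
theorem exists_mul_mem_of_le_sup (n I F : Ideal R) (hI : I.FG) (h : I ≤ F ⊔ n * I) :
    ∃ u : R, u - 1 ∈ n ∧ ∀ x ∈ I, u * x ∈ F := by
  obtain ⟨u, hu, hu'⟩ := Submodule.exists_sub_one_mem_and_smul_eq_zero_of_fg_of_le_smul n
    (Submodule.map F.mkQ I) (Submodule.FG.map _ hI) (by
      rw [← Submodule.map_smul'']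
      have h1 := Submodule.map_mono (f := F.mkQ) h
      rwa [Submodule.map_sup, Submodule.mkQ_map_self, bot_sup_eq] at h1)
  refine ⟨u, hu, fun x hx => ?_⟩
  have h1 := hu' _ ⟨x, hx, rfl⟩
  rw [← map_smul] at h1
  exact (Submodule.Quotient.mk_eq_zero F).1 h1

theorem exists_pow_inf_le_mul [IsNoetherianRing R] (n I : Ideal R) :
    ∃ k, n ^ k ⊓ I ≤ n * I := by
  obtain ⟨k, hk⟩ := Ideal.exists_pow_inf_eq_pow_smul n I
  refine ⟨k + 1, ?_⟩
  have h := hk (k + 1) (Nat.le_succ k)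
  rw [smul_eq_mul, Ideal.mul_top, Nat.add_sub_cancel_left, pow_one] at h
  rw [h]
  exact Ideal.mul_mono_right inf_le_right

end Nakayama

/-! ### Inverting an element and translating the variables -/

section Localize

variable {O T : Type*} [CommRing O] [CommRing T] [Algebra O T] {n : ℕ}

/-- If the `fⱼ` generate the kernel of `O[X₁, …, Xₙ] → T` up to multiplication with an element `u`
whose image is invertible, then a presentation is obtained by inverting `u`. -/
theorem ker_aeval_cons (t : Fin n → T) (u : MvPolynomial (Fin n) O)
    {ι : Type*} (f : ι → MvPolynomial (Fin n) O) (hf : ∀ j, aeval t (f j) = 0)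
    (hu : ∀ p, aeval t p = 0 → u * p ∈ Ideal.span (Set.range f)) (v : T)
    (hv : aeval t u * v = 1) (p : MvPolynomial (Fin (n + 1)) O) :
    aeval (Fin.cons v t : Fin (n + 1) → T) p = 0 ↔
      p ∈ Ideal.span (insert (rename Fin.succ u * X 0 - 1)
        (Set.range fun j => rename Fin.succ (f j))) := by
  set I : Ideal (MvPolynomial (Fin (n + 1)) O) :=
    Ideal.span (insert (rename Fin.succ u * X 0 - 1) (Set.range fun j => rename Fin.succ (f j)))
  have hren : ∀ q : MvPolynomial (Fin n) O,
      aeval (Fin.cons v t : Fin (n + 1) → T) (rename Fin.succ q) = aeval t q := by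
    intro q
    rw [aeval_rename]
    rfl
  have h0 : rename Fin.succ u * X 0 - 1 ∈ I := Ideal.subset_span (Set.mem_insert _ _)
  constructor
  · intro hp
    -- Modulo `u X₀ - 1`, a power of `u` clears the variable `X₀`; multiplying by `X₀ ^ (k + 1)` at
    -- the end undoes this.
    have h1 : ∀ p : MvPolynomial (Fin (n + 1)) O, ∃ (k : ℕ) (q : MvPolynomial (Fin n) O),
        rename Fin.succ u ^ k * p - rename Fin.succ q ∈ I := by
      intro p
      induction p using MvPolynomial.induction_on with
      | C a => exact ⟨0, C a, by simp⟩
      | add p p' hp hp' =>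
        obtain ⟨k, q, h⟩ := hp
        obtain ⟨k', q', h'⟩ := hp'
        refine ⟨k + k', u ^ k' * q + u ^ k * q', ?_⟩
        convert add_mem (Ideal.mul_mem_left _ (rename Fin.succ u ^ k') h)
          (Ideal.mul_mem_left _ (rename Fin.succ u ^ k) h') using 1
        simp only [map_add, map_mul, map_pow]
        ring
      | mul_X p i hp =>
        obtain ⟨k, q, h⟩ := hp
        refine Fin.cases ?_ (fun i => ?_) i
        · refine ⟨k + 1, q, ?_⟩
          convert add_mem (Ideal.mul_mem_left _ (rename Fin.succ u ^ k * p) h0) h using 1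
          ring
        · refine ⟨k, q * X i, ?_⟩
          convert Ideal.mul_mem_right (X i.succ) _ h using 1
          simp only [map_mul, rename_X]
          ring
    obtain ⟨k, q, hq⟩ := h1 p
    have hI : ∀ x ∈ I, aeval (Fin.cons v t : Fin (n + 1) → T) x = 0 := by
      have : I ≤ RingHom.ker (aeval (R := O) (Fin.cons v t : Fin (n + 1) → T)) := by
        rw [Ideal.span_le]
        rintro _ (rfl | ⟨j, rfl⟩)
        · change aeval _ _ = 0
          simp [hren, hv]
        · change aeval _ _ = 0
          rw [hren, hf]
      exact this
    have hq0 : aeval t q = 0 := by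
      have := hI _ hq
      rw [map_sub, map_mul, hp, mul_zero, zero_sub, neg_eq_zero, hren] at this
      exact this
    have h2 : rename Fin.succ (u * q) ∈ I := by
      have h3 := Ideal.mem_map_of_mem (rename (R := O) Fin.succ) (hu q hq0)
      rw [Ideal.map_span, ← Set.range_comp] at h3
      exact Ideal.span_mono (Set.subset_insert _ _) h3
    have h3 : rename Fin.succ u ^ (k + 1) * p ∈ I := by
      rw [map_mul] at h2
      convert add_mem h2 (Ideal.mul_mem_left _ (rename Fin.succ u) hq) using 1
      ring
    have h4 : 1 - (rename Fin.succ u * X 0) ^ (k + 1) ∈ I := by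
      have h5 : (1 : MvPolynomial (Fin (n + 1)) O) - rename Fin.succ u * X 0 ∈ I := by
        rw [← neg_sub]
        exact neg_mem h0
      refine Ideal.mem_of_dvd _ ?_ h5
      simpa using sub_dvd_pow_sub_pow (1 : MvPolynomial (Fin (n + 1)) O)
        (rename Fin.succ u * X 0) (k + 1)
    convert add_mem (Ideal.mul_mem_right p _ h4) (Ideal.mul_mem_left _ (X 0 ^ (k + 1)) h3) using 1
    ring
  · intro hp
    have : I ≤ RingHom.ker (aeval (R := O) (Fin.cons v t : Fin (n + 1) → T)) := by
      rw [Ideal.span_le]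
      rintro _ (rfl | ⟨j, rfl⟩)
      · change aeval _ _ = 0
        simp [hren, hv]
      · change aeval _ _ = 0
        rw [hren, hf]
    exact this hp

/-- The variables of a presentation can be translated into the kernel of `λ`. -/
theorem exists_isPresentation_of_ker_eq (lam : T →ₐ[O] O) (t : Fin n → T)
    (hsurj : Function.Surjective (aeval (R := O) t)) (f : Fin (n + 1) → MvPolynomial (Fin n) O)
    (hker : RingHom.ker (aeval (R := O) t) = Ideal.span (Set.range f)) :
    ∃ (t' : Fin n → T) (f' : Fin (n + 1) → MvPolynomial (Fin n) O), IsPresentation lam t' f' := by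
  let τ : MvPolynomial (Fin n) O →ₐ[O] MvPolynomial (Fin n) O :=
    aeval fun i => X i - C (lam (t i))
  let τ' : MvPolynomial (Fin n) O →ₐ[O] MvPolynomial (Fin n) O :=
    aeval fun i => X i + C (lam (t i))
  have hτ : ∀ p, τ (τ' p) = p := by
    have : τ.comp τ' = AlgHom.id O _ := by
      ext1 i
      simp [τ, τ', algebraMap_eq]
    exact fun p => DFunLike.congr_fun this p
  have hτ' : ∀ p, τ' (τ p) = p := by
    have : τ'.comp τ = AlgHom.id O _ := by
      ext1 i
      simp [τ, τ', algebraMap_eq]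
    exact fun p => DFunLike.congr_fun this p
  let t' : Fin n → T := fun i => t i - algebraMap O T (lam (t i))
  have ht' : ∀ p, aeval t' p = aeval t (τ p) := by
    have : aeval t' = (aeval t).comp τ := by
      ext1 i
      simp [τ, t']
    exact fun p => DFunLike.congr_fun this p
  refine ⟨t', fun j => τ' (f j), fun i => ?_, fun x => ?_, ?_⟩
  · rw [map_sub, AlgHom.commutes]
    exact sub_self _
  · obtain ⟨p, rfl⟩ := hsurj x
    exact ⟨τ' p, by rw [ht', hτ]⟩
  · ext p
    rw [RingHom.mem_ker, ht', ← RingHom.mem_ker, hker]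
    have e : Set.range (fun j => τ' (f j)) = τ' '' Set.range f := by
      rw [← Set.range_comp]
      rfl
    rw [e, ← Ideal.map_span]
    constructor
    · intro h
      rw [← hτ' p]
      exact Ideal.mem_map_of_mem _ h
    · intro h
      have h1 : Ideal.map τ' (Ideal.span (Set.range f)) ≤
          Ideal.comap τ (Ideal.span (Set.range f)) := by
        rw [Ideal.map_le_iff_le_comap]
        intro x hx
        rwa [Ideal.mem_comap, Ideal.mem_comap, hτ]
      exact h1 h

end Localize

/-! ### Polynomial presentations of finite local algebras -/

section Presentation

variable {O T : Type*} [CommRing O] [CommRing T] [Algebra O T] {g : ℕ}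

theorem apply_algebraMap (q : MvPowerSeries (Fin g) O →ₐ[O] T) (p : MvPolynomial (Fin g) O) :
    q (algebraMap _ _ p) = aeval (fun i => q (MvPowerSeries.X i)) p := by
  have : q.comp (IsScalarTower.toAlgHom O (MvPolynomial (Fin g) O) (MvPowerSeries (Fin g) O)) =
      aeval (fun i => q (MvPowerSeries.X i)) := by
    ext1 i
    rw [aeval_X, AlgHom.comp_apply]
    exact congrArg q (MvPolynomial.coe_X i)
  exact DFunLike.congr_fun this p

variable [IsLocalRing O] [IsLocalRing T]

/-- A nonunit of `O` stays one in `T` because `λ` sends units to units. No variable becomes a unit,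
because `1 - Xᵢ s` is invertible for every power series `s`. -/
theorem map_originIdeal_le_maximalIdeal (lam : T →ₐ[O] O) (q : MvPowerSeries (Fin g) O →ₐ[O] T)
    (hq : Function.Surjective q) :
    (originIdeal (Fin g) (IsLocalRing.maximalIdeal O)).map
      (aeval (R := O) fun i => q (MvPowerSeries.X i)) ≤ IsLocalRing.maximalIdeal T := by
  rw [originIdeal, Ideal.map_sup, sup_le_iff]
  constructor
  · rw [Ideal.map_le_iff_le_comap, Ideal.map_le_iff_le_comap]
    intro a ha
    rw [Ideal.mem_comap, Ideal.mem_comap, aeval_C, IsLocalRing.mem_maximalIdeal, mem_nonunits_iff]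
    intro h
    have h1 := h.map lam
    rw [AlgHom.commutes] at h1
    exact ha h1
  · rw [idealOfVars, Ideal.map_span, Ideal.span_le]
    rintro _ ⟨_, ⟨i, rfl⟩, rfl⟩
    rw [aeval_X, SetLike.mem_coe, IsLocalRing.mem_maximalIdeal, mem_nonunits_iff]
    intro h
    obtain ⟨v, hv⟩ := h.exists_right_inv
    obtain ⟨s, rfl⟩ := hq v
    have h1 : IsUnit (1 - MvPowerSeries.X i * s) := by
      rw [MvPowerSeries.isUnit_iff_constantCoeff]
      simp
    have h2 := h1.map q
    rw [map_sub, map_mul, hv, map_one, sub_self] at h2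
    exact not_isUnit_zero h2

variable [IsNoetherianRing O] [Module.Finite O T]

theorem exists_maximalIdeal_pow_le_map :
    ∃ k, IsLocalRing.maximalIdeal T ^ k ≤ (IsLocalRing.maximalIdeal O).map (algebraMap O T) := by
  have : IsArtinianRing (T ⧸ (IsLocalRing.maximalIdeal O).map (algebraMap O T)) := by
    have : Module.Finite (O ⧸ IsLocalRing.maximalIdeal O)
      (T ⧸ (IsLocalRing.maximalIdeal O).map (algebraMap O T)) := inferInstance
    have : IsArtinianRing (O ⧸ IsLocalRing.maximalIdeal O) := by
      let _ := Ideal.Quotient.field (IsLocalRing.maximalIdeal O)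
      infer_instance
    exact IsArtinianRing.of_finite (O ⧸ IsLocalRing.maximalIdeal O) _
  exact IsLocalRing.exists_maximalIdeal_pow_le_of_isArtinianRing_quotient _

/-- A power of the maximal ideal of `T` lies in `m T`, so polynomial approximation gives
surjectivity modulo `m`; Nakayama's lemma finishes. -/
theorem surjective_aeval_X (lam : T →ₐ[O] O) (q : MvPowerSeries (Fin g) O →ₐ[O] T)
    (hq : Function.Surjective q) :
    Function.Surjective (aeval (R := O) fun i => q (MvPowerSeries.X i)) := by
  set π : MvPolynomial (Fin g) O →ₐ[O] T := aeval (R := O) fun i => q (MvPowerSeries.X i) with hπ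
  set m := IsLocalRing.maximalIdeal O
  have hle := map_originIdeal_le_maximalIdeal lam q hq
  obtain ⟨k, hk⟩ := exists_maximalIdeal_pow_le_map (O := O) (T := T)
  have h1 : (⊤ : Submodule O T) ≤ LinearMap.range π.toLinearMap ⊔ m • ⊤ := by
    rintro x -
    obtain ⟨s, rfl⟩ := hq x
    obtain ⟨p, hp⟩ := exists_sub_mem_map_originIdeal_pow m k s
    have h2 : q (s - algebraMap _ _ p) ∈ m.map (algebraMap O T) := by
      refine hk ?_
      have h3 := Ideal.mem_map_of_mem q hp
      rw [← Ideal.mem_comap] at h3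
      have h4 : (originIdeal (Fin g) m ^ k).map
          (algebraMap (MvPolynomial (Fin g) O) (MvPowerSeries (Fin g) O)) ≤
          Ideal.comap q (IsLocalRing.maximalIdeal T ^ k) := by
        rw [Ideal.map_le_iff_le_comap]
        intro a ha
        rw [Ideal.mem_comap, Ideal.mem_comap, apply_algebraMap]
        have h5 := Ideal.mem_map_of_mem π ha
        rw [Ideal.map_pow] at h5
        exact Ideal.pow_right_mono hle k h5
      exact h4 hp
    rw [map_sub, apply_algebraMap] at h2
    rw [← sub_add_cancel (q s) (π p)]
    refine add_mem (Submodule.mem_sup_right ?_) (Submodule.mem_sup_left ⟨p, rfl⟩)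
    rw [Ideal.smul_top_eq_map]
    exact h2
  have h2 := Submodule.le_of_le_smul_of_le_jacobson_bot (N := LinearMap.range π.toLinearMap)
    (N' := ⊤) (I := m) Module.Finite.fg_top (IsLocalRing.maximalIdeal_le_jacobson _) h1
  intro x
  exact h2 (Submodule.mem_top : x ∈ ⊤)

/-- A quotient of a power series ring in `g` variables by `g + 1` relations which is finite over
`O` is a quotient of a polynomial ring in `g + 1` variables by `g + 2` relations. -/
theorem exists_isPresentation (lam : T →ₐ[O] O) (q : MvPowerSeries (Fin g) O →ₐ[O] T)
    (hq : Function.Surjective q) (f : Fin (g + 1) → MvPowerSeries (Fin g) O)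
    (hker : RingHom.ker q = Ideal.span (Set.range f)) :
    ∃ (t : Fin (g + 1) → T) (f' : Fin (g + 1 + 1) → MvPolynomial (Fin (g + 1)) O),
      IsPresentation lam t f' := by
  have hsurj := surjective_aeval_X lam q hq
  have hloc := map_originIdeal_le_maximalIdeal lam q hq
  have hqp := apply_algebraMap q
  set t : Fin g → T := fun i => q (MvPowerSeries.X i)
  set n := originIdeal (Fin g) (IsLocalRing.maximalIdeal O)
  set I : Ideal (MvPolynomial (Fin g) O) := RingHom.ker (aeval (R := O) t) with hI
  set ι := algebraMap (MvPolynomial (Fin g) O) (MvPowerSeries (Fin g) O)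
  obtain ⟨k, hk⟩ := exists_pow_inf_le_mul n I
  -- elements of the kernel are approximated by elements of `I`
  have happrox : ∀ s : MvPowerSeries (Fin g) O, q s = 0 →
      ∃ p ∈ I, s - ι p ∈ (n ^ k).map ι := by
    intro s hs
    obtain ⟨p, hp⟩ := exists_sub_mem_map_originIdeal_pow (IsLocalRing.maximalIdeal O) k s
    have h1 : q (s - ι p) ∈ (n ^ k).map (aeval (R := O) t) := by
      have h2 : (n ^ k).map ι ≤ Ideal.comap q ((n ^ k).map (aeval (R := O) t)) := by
        rw [Ideal.map_le_iff_le_comap]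
        intro a ha
        rw [Ideal.mem_comap, Ideal.mem_comap, hqp]
        exact Ideal.mem_map_of_mem _ ha
      exact h2 hp
    -- The approximation `p` need not lie in `I`; its defect is the image of some `a ∈ n ^ k`, and
    -- `p + a` does.
    obtain ⟨a, ha, ha'⟩ := (Ideal.mem_map_iff_of_surjective _ hsurj).1 h1
    refine ⟨p + a, ?_, ?_⟩
    · rw [hI, RingHom.mem_ker, map_add]
      erw [ha']
      rw [map_sub, hs, hqp]
      ring
    · rw [map_add, ← sub_sub]
      exact sub_mem hp (Ideal.mem_map_of_mem _ ha)
  have hf0 : ∀ j, q (f j) = 0 := fun j => by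
    rw [← RingHom.mem_ker, hker]
    exact Ideal.subset_span ⟨j, rfl⟩
  choose f' hf' hff' using fun j => happrox (f j) (hf0 j)
  have hsup : I ≤ Ideal.span (Set.range f') ⊔ n * I := by
    intro p hp
    have h1 : ι p ∈ Ideal.span (Set.range f) := by
      rw [← hker, RingHom.mem_ker, hqp]
      exact hp
    obtain ⟨c, hc⟩ := Ideal.mem_span_range_iff_exists_fun.1 h1
    choose d hd using fun j =>
      exists_sub_mem_map_originIdeal_pow (IsLocalRing.maximalIdeal O) k (c j)
    have h2 : p - ∑ j, d j * f' j ∈ n ^ k := by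
      refine mem_originIdeal_pow_of_algebraMap_mem _ k _ ?_
      rw [map_sub, map_sum, ← hc, ← Finset.sum_sub_distrib]
      refine sum_mem fun j _ => ?_
      have e : c j * f j - ι (d j * f' j) = f j * (c j - ι (d j)) + ι (d j) * (f j - ι (f' j)) := by
        rw [map_mul]
        ring
      rw [e]
      exact add_mem (Ideal.mul_mem_left _ _ (hd j)) (Ideal.mul_mem_left _ _ (hff' j))
    have h3 : ∑ j, d j * f' j ∈ I := sum_mem fun j _ => Ideal.mul_mem_left _ _ (hf' j)
    rw [← sub_add_cancel p (∑ j, d j * f' j)]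
    exact add_mem (Submodule.mem_sup_right (hk ⟨h2, sub_mem hp h3⟩))
      (Submodule.mem_sup_left
        (sum_mem fun j _ => Ideal.mul_mem_left _ _ (Ideal.subset_span ⟨j, rfl⟩)))
  -- The approximations `f'` generate `I` only after multiplication by some `u ≡ 1` modulo `n`. Its
  -- image in `T` is a unit, so adjoining an inverse of `u` costs one variable and one relation.
  obtain ⟨u, hu, huI⟩ := exists_mul_mem_of_le_sup n I _ (IsNoetherian.noetherian I) hsup
  have hunit : IsUnit (aeval t u) := by
    have h1 := hloc (Ideal.mem_map_of_mem _ hu)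
    rw [map_sub, map_one] at h1
    by_contra h
    exact IsLocalRing.maximalIdeal.isMaximal T |>.ne_top ((Ideal.eq_top_iff_one _).2
      (by simpa using sub_mem ((IsLocalRing.mem_maximalIdeal _).2 h) h1))
  obtain ⟨v, hv⟩ := hunit.exists_right_inv
  have hcons := ker_aeval_cons t u f' hf' huI v hv
  refine exists_isPresentation_of_ker_eq lam (Fin.cons v t) (fun x => ?_)
    (Fin.cons (rename Fin.succ u * X 0 - 1) fun j => rename Fin.succ (f' j)) ?_
  · obtain ⟨p, rfl⟩ := hsurj x
    refine ⟨rename Fin.succ p, ?_⟩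
    rw [aeval_rename]
    rfl
  · ext p
    rw [Fin.range_cons]
    exact hcons p

end Presentation

theorem IsPresentation.fittingCotangentH1_eq {O T : Type*} [CommRing O] [CommRing T] [Algebra O T]
    {lam : T →ₐ[O] O} {n : ℕ} {t : Fin n → T} {f : Fin (n + 1) → MvPolynomial (Fin n) O}
    (hP : IsPresentation lam t f) (w : O) (x₀ : MvPolynomial (Fin n) O)
    (hx₀ : aeval t x₀ = 0) (hx₀' : x₀ ∈ idealOfVars (Fin n) O ^ 2)
    (hgen : ∀ x, aeval t x = 0 → x ∈ idealOfVars (Fin n) O ^ 2 → ∃ a : O,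
      x - C a * x₀ ∈ idealOfVars (Fin n) O * RingHom.ker (aeval (R := O) t))
    (hw : ∀ a : O, C a * x₀ ∈ idealOfVars (Fin n) O * RingHom.ker (aeval (R := O) t) ↔ w ∣ a) :
    fittingCotangentH1 lam = Ideal.span {w} := by
  let _ : Algebra T O := lam.toRingHom.toAlgebra
  have _ : IsScalarTower O T O := IsScalarTower.of_algebraMap_eq fun x => (lam.commutes x).symm
  have hlam : IsScalarTower.toAlgHom O T O = lam := AlgHom.ext fun _ => rfl
  have hker : RingHom.ker ((IsScalarTower.toAlgHom O T O).comp (aeval (R := O) t)) =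
      idealOfVars (Fin n) O := by
    ext p
    rw [hlam, mem_idealOfVars_iff, RingHom.mem_ker, AlgHom.comp_apply,
      apply_aeval lam t hP.apply_eq_zero]
  -- Lifting each element of `T` maps `O[T]` to `O[X₁,…,Xₙ]` over `T`; the map back is `Xᵢ ↦ [tᵢ]`.
  choose s hs using hP.surjective
  let φ : Res O T 0 →ₐ[O] MvPolynomial (Fin n) O :=
    (aeval s : MvPolynomial T O →ₐ[O] MvPolynomial (Fin n) O)
  have hφ : (aeval t).comp φ = aug O T 0 := by
    refine MvPolynomial.algHom_ext (A := T) fun x => ?_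
    change aeval t (aeval s (X x : MvPolynomial T O)) = aug O T 0 (var₀ O T x)
    rw [aeval_X, hs, aug_var₀]
  refine fittingIdeal_cotangentH1 (aeval t) φ hφ (aeval fun i => var₀ O T (t i)) ?_ w x₀ hx₀ ?_ ?_ ?_
  · ext i
    simp [aug_var₀]
  · rwa [hker]
  · intro x hx hx'
    rw [hker] at hx' ⊢
    simpa only [C_mul'] using hgen x hx hx'
  · intro a
    rw [hker, ← C_mul']
    exact hw a

end WilesDefect
end

/-! ### The Wiles defect formula -/

theorem proposition2p5 {O : Type*} [CommRing O] [IsDomain O] [IsDiscreteValuationRing O]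
    [CharZero O] (K : Type*) [Field K] [Algebra O K] [IsFractionRing O K]
    {T : Type*} [CommRing T] [Algebra O T] [IsLocalRing T] [Module.Finite O T]
    [IsSemisimpleRing (K ⊗[O] T)] (lam : T →ₐ[O] O)
    (g : ℕ) (f : Fin (g + 1) → MvPowerSeries (Fin g) O)
    (presentation : (MvPowerSeries (Fin g) O ⧸ Ideal.span (Set.range f)) ≃ₐ[O] T) :
    WilesDefect.wilesDefect K lam =
      (WilesDefect.fittingCotangentH1 lam : FractionalIdeal O⁰ K) := by
  let q : MvPowerSeries (Fin g) O →ₐ[O] T :=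
    presentation.toAlgHom.comp (Ideal.Quotient.mkₐ O (Ideal.span (Set.range f)))
  have hq : Function.Surjective q :=
    presentation.surjective.comp (Ideal.Quotient.mkₐ_surjective O _)
  have hker : RingHom.ker q = Ideal.span (Set.range f) := by
    ext s
    rw [RingHom.mem_ker, ← Ideal.Quotient.eq_zero_iff_mem]
    exact map_eq_zero_iff presentation presentation.injective
  obtain ⟨t, f', hP⟩ := WilesDefect.exists_isPresentation lam q hq f hker
  obtain ⟨b, hb0, hb⟩ := WilesDefect.exists_smul_ker_mem_sq K lam
  obtain ⟨w, δ, hδ, hC1, ⟨x₀, hx₀, hx₀', hgen, hw⟩, hcong⟩ := hP.exists_invariants b hb0 hb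
  have hδ' : algebraMap O K δ ≠ 0 := by simpa using hδ
  -- The identity becomes `(δ w)(δ)⁻¹ = (w)`.
  rw [WilesDefect.wilesDefect, hC1, WilesDefect.congruenceIdeal_eq K lam δ hcong,
    hP.fittingCotangentH1_eq w x₀ hx₀ hx₀' hgen hw, FractionalIdeal.coeIdeal_span_singleton,
    FractionalIdeal.coeIdeal_span_singleton, FractionalIdeal.coeIdeal_span_singleton,
    FractionalIdeal.spanSingleton_inv, FractionalIdeal.spanSingleton_mul_spanSingleton, map_mul,
    mul_comm, inv_mul_cancel_left₀ hδ']
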